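/- **Setting.** Let $\theta_0$ (the target) and $\theta_1,\dots,\theta_L$ (the protected vectors) be unknown vectors in $\mathbb R^d$ with $\|\theta_j\|_2\le 1$. In round $t$ a learner picks an action $A_t\in\mathcal B_2^d=\{a\in\mathbb R^d:\|a\|_2\le 1\}$ and an index $I_t\in\{0,1,\dots,L\}$ and observes $X_t=\langle A_t,\theta_{I_t}\rangle+\eta_t$. There is a filtration $(\mathcal F_t)$ such that $A_t,I_t$ are $\mathcal F_{t-1}$-measurable, $\eta_t$ is $\mathcal F_t$-measurable, $\mathbb E[\eta_t\mid\mathcal F_{t-1}]=0$ and $\mathbb E[e^{x\eta_t}\mid\mathcal F_{t-1}]\le e^{x^2/2}$ for all $x\in\mathbb R$. For vectors $v_i$, $i\in S$, let $\lambda_{\min}(\sum_{i\in S}v_iv_i^\top)$ be the smallest non-zero eigenvalue of this matrix if the $v_i$, $i\in S$, are linearly independent, and $0$ otherwise. Let $s$ be such that $\lambda_{\min}(\sum_{i\in S}\theta_i\theta_i^\top)>0$ for some $S\subseteq\{1,\dots,L\}$ with $|S|=s$, while this quantity is $0$ for all $S$ with $|S|>s$; let $\lambda_{\min}$ be its maximum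 over the sets $S\subseteq\{1,\dots,L\}$ with $|S|=s$. With $\theta_\perp$ the orthogonal projection of $\theta_0$ onto the orthogonal complement of $\mathrm{span}(\theta_1,\dots,\theta_L)$ and $a^*\in\arg\max_{a\in\mathcal B_2^d}\langle a,\theta_\perp\rangle$, the pseudo-regret is $\mathcal R_{[T]}=\sum_{t\le T}\langle a^*-A_t,\theta_\perp\rangle$. Put $$\sqrt{\beta_t(\delta)}=\sqrt{d\log\big((1+t)/\delta\big)}+1 .$$ **Algorithm (Protected LinUCB), given $s$ and $\delta\in(0,1)$.** For a set $U$ of rounds and $\rho\ge0$ let $V=\rho I+\sum_{u\in U}A_uA_u^\top$ and $\hat\theta=V^{-1}\sum_{u\in U}X_uA_u$ (and $\hat\theta=0$ if $U=\emptyset$). *CORE-SET phase:* put $\delta'=\delta/(2L)$ and $t=1$. While every $S\subseteq\{1,\dots,L\}$ with $|S|=s$ has $$\lambda_{\min}\Big(\sum_{i\in S}\hat\theta_i\hat\theta_i^\top\Big)\le \frac{32L\,(d\log 6+\log(1/\delta'))}{\sqrt t},$$ play every pair $(e_i,p)$, $i=1,\dots,d$, $p=1,\dots,L$, once (the $e_i$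 being the standard basis vectors), and increase $t$ by one. Here $\hat\theta_p$ is computed from the rounds so far in which $p$ was queried, with $\rho=1$ or with $\rho=0$ (the result holds for both). When the loop ends, let $\tilde S$ maximise $\lambda_{\min}(\sum_{i\in S}\hat\theta_i\hat\theta_i^\top)$ over $|S|=s$. *Optimistic phase:* from then on, for $j\in\{0\}\cup\tilde S$, let $T_j,V_j,\hat\theta_j$ be the number of rounds of this phase so far in which $j$ was queried and the quantities $V,\hat\theta$ formed from these rounds with $\rho=1$, and put $\Theta_j=\{\vartheta:\|\hat\theta_j-\vartheta\|_{V_j}\le\sqrt{\beta_{T_j}(\delta/(2(L+1)))}\}$, where $\|x\|_V=\sqrt{x^\top Vx}$. In each round play an action $A_t$ that, together with some $\bar\theta_j\in\Theta_j$, maximises $\langle a,\mathrm{Proj}^\perp_{\{\vartheta_i\}_{i\in\tilde S}}\vartheta_0\rangle$ over all $a\in\mathcal B_2^d$ and $\vartheta_j\in\Theta_j$, $j\in\{0\}\cup\tilde S$, and query an index $I_t\in\arg\max_{j\in\{0\}\cup\tilde S}\|A_t\|_{V_j^{-1}}\sqrt{\beta_{T_j}(\delta/(2(L+1)))}$. Ties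 are broken arbitrarily. The algorithm is stopped after $T$ rounds in total. **Theorem.** For every $T$, with probability at least $1-\delta$, $$\mathcal R_{[T]}\le 12\sqrt2\,\frac{s+1}{\lambda_{\min}}\sqrt{Td\log\Big(1+\frac{TL}{d}\Big)}\,\sqrt{\beta_T\Big(\frac{\delta}{2(L+1)}\Big)}+\frac{4608\,L^3d\,\big(d\log 6+\log\frac{2L}{\delta}\big)^2}{\lambda_{\min}^2},$$ and, on the same event, also $$\mathcal R_{[T]}\le 2\sqrt{\Big(\Big(\frac{3\sqrt s}{\lambda_{\min}}+1\Big)^2\beta_T\Big(\frac{\delta}{2(L+1)}\Big)+1\Big)(s+1)Td\log\Big(1+\frac{TL}{d}\Big)}+\frac{4608\,L^3d\,\big(d\log 6+\log\frac{2L}{\delta}\big)^2}{\lambda_{\min}^2}.$$ The $T$-dependent term of the first bound is $\tilde O(sd\sqrt T)$: it is at most $\frac{48\sqrt2}{\lambda_{\min}}\,sd\sqrt T\,\log\frac{2(L+1)(T+1)}{\delta}$. -/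

import Mathlib

open MeasureTheory
open scoped InnerProductSpace Matrix

noncomputable section

namespace ProtectedBandit

/-- The Euclidean space `ℝ^d`. -/
abbrev Vec (d : ℕ) : Type := EuclideanSpace ℝ (Fin d)

/-! ### Linear algebra -/

/-- The rank-one matrix `x xᵀ`. -/
def outer {d : ℕ} (x : Vec d) : Matrix (Fin d) (Fin d) ℝ :=
  Matrix.vecMulVec x.ofLp x.ofLp

/-- `λ_min (∑_{i ∈ S} v_i v_iᵀ)`: the smallest non-zero eigenvalue of this `d × d` matrix if the
vectors `v_i`, `i ∈ S`, are linearly independent, and `0` if they are linearly dependent.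
(Equivalently, the `|S|`-th largest eigenvalue of the matrix.) -/
def lamMin {d : ℕ} {ι : Type*} (v : ι → Vec d) (S : Finset ι) : ℝ :=
  open Classical in
  if LinearIndependent ℝ (fun i : S => v i) then
    sInf {x : ℝ | x ≠ 0 ∧ Module.End.HasEigenvalue (Matrix.toLin' (∑ i ∈ S, outer (v i))) x}
  else 0

/-- Orthogonal projection of `x` onto the orthogonal complement of the span of `W`. -/
def projPerp {d : ℕ} (W : Set (Vec d)) (x : Vec d) : Vec d :=
  (Submodule.span ℝ W)ᗮ.starProjection x

/-- The weighted norm `‖x‖_V = √(xᵀ V x)`. -/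
def weightedNorm {d : ℕ} (V : Matrix (Fin d) (Fin d) ℝ) (x : Vec d) : ℝ :=
  √(x.ofLp ⬝ᵥ (V *ᵥ x.ofLp))

/-! ### Regularised least squares and confidence ellipsoids

`A u` and `X u` are the action and the feedback of round `u`; `U` is a finite set of rounds. -/

/-- The design matrix `V = ρ I + ∑_{u ∈ U} A_u A_uᵀ`. -/
def design {d : ℕ} (ρ : ℝ) (A : ℕ → Vec d) (U : Finset ℕ) : Matrix (Fin d) (Fin d) ℝ :=
  ρ • (1 : Matrix (Fin d) (Fin d) ℝ) + ∑ u ∈ U, outer (A u)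

/-- The regularised least squares estimate `V⁻¹ ∑_{u ∈ U} A_u X_u`. -/
def estimate {d : ℕ} (ρ : ℝ) (A : ℕ → Vec d) (X : ℕ → ℝ) (U : Finset ℕ) : Vec d :=
  WithLp.toLp 2 ((design ρ A U)⁻¹ *ᵥ ∑ u ∈ U, X u • (A u).ofLp)

/-- The radius `√(β_t(δ)) = R √(d log ((1 + t M² / ρ) / δ)) + √ρ M`. -/
def sqrtBeta (d : ℕ) (M R ρ δ : ℝ) (t : ℕ) : ℝ :=
  R * √(d * Real.log ((1 + t * M ^ 2 / ρ) / δ)) + √ρ * M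

/-- The confidence ellipsoid `{ϑ : ‖θ̂ - ϑ‖_V ≤ √(β_{|U|}(δ))}` built from the rounds in `U`. -/
def confSet {d : ℕ} (M R ρ δ : ℝ) (A : ℕ → Vec d) (X : ℕ → ℝ) (U : Finset ℕ) : Set (Vec d) :=
  {ϑ | weightedNorm (design ρ A U) (estimate ρ A X U - ϑ) ≤ sqrtBeta d M R ρ δ U.card}

/-- The rounds `u` with `lo ≤ u < hi` in which the index `j` was queried. -/
def queried {L : ℕ} (I : ℕ → Fin (L + 1)) (j : Fin (L + 1)) (lo hi : ℕ) : Finset ℕ :=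
  (Finset.Ico lo hi).filter (fun u => I u = j)

/-! ### The CORE-SET phase

Index `0` is the target vector, the indices `p.succ` with `p : Fin L` are the protected vectors.
Rounds are numbered `0, 1, 2, …`; the `n`-th pass (`n = 0, 1, …`) through the outer loop consists of
the `d * L` rounds `n * (d * L) + i * L + p`. -/

/-- The estimates of the protected vectors after `n` complete passes, with regulariser `ρ₀`. -/
def coreEstimate {d L : ℕ} (ρ₀ : ℝ) (A : ℕ → Vec d) (I : ℕ → Fin (L + 1)) (X : ℕ → ℝ)
    (n : ℕ) (p : Fin L) : Vec d :=
  estimate ρ₀ A X (queried I p.succ 0 (n * (d * L)))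

/-- The condition of the while loop after `n` complete passes, at confidence level `δ`
(the loop counter, which starts at `1`, is then `n + 1`). -/
def coreContinue {d L : ℕ} (s : ℕ) (M R ρ₀ δ : ℝ) (A : ℕ → Vec d) (I : ℕ → Fin (L + 1))
    (X : ℕ → ℝ) (n : ℕ) : Prop :=
  ∀ S : Finset (Fin L), S.card = s →
    lamMin (coreEstimate ρ₀ A I X n) S ≤
      16 * L * R * (M + R) * (d * Real.log 6 + Real.log (1 / δ)) / √((n : ℝ) + 1)

/-- The CORE-SET loop ends after exactly `n` passes. -/
def coreEnds {d L : ℕ} (s : ℕ) (M R ρ₀ δ : ℝ) (A : ℕ → Vec d) (I : ℕ → Fin (L + 1))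
    (X : ℕ → ℝ) (n : ℕ) : Prop :=
  (∀ m < n, coreContinue s M R ρ₀ δ A I X m) ∧ ¬ coreContinue s M R ρ₀ δ A I X n

/-- `S` is an admissible output of CORE-SET after `n` passes: a maximiser of
`λ_min (∑_{i ∈ S} θ̂_i θ̂_iᵀ)` among the sets of cardinality `s`. -/
def isCoreSet {d L : ℕ} (s : ℕ) (ρ₀ : ℝ) (A : ℕ → Vec d) (I : ℕ → Fin (L + 1))
    (X : ℕ → ℝ) (n : ℕ) (S : Finset (Fin L)) : Prop :=
  S.card = s ∧ ∀ S' : Finset (Fin L), S'.card = s →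
    lamMin (coreEstimate ρ₀ A I X n) S' ≤ lamMin (coreEstimate ρ₀ A I X n) S

/-! ### The optimistic phase -/

/-- The indices `{0} ∪ S` in use after the core set `S` has been found. -/
def coreIndices {L : ℕ} (S : Finset (Fin L)) : Finset (Fin (L + 1)) :=
  insert 0 (S.map (Fin.succEmb L))

/-- The objective `⟨a, Proj^⊥_{ϑ_i, i ∈ S} ϑ_0⟩`. -/
def value {d L : ℕ} (S : Finset (Fin L)) (a : Vec d) (ϑ : Fin (L + 1) → Vec d) : ℝ :=
  ⟪a, projPerp ((fun p : Fin L => ϑ p.succ) '' (S : Set (Fin L))) (ϑ 0)⟫_ℝ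

/-- `(a, ϑ)` is feasible in round `t`: `a` is in the closed unit ball, and each `ϑ_j`, `j ∈ {0} ∪ S`,
is in the current confidence ellipsoid, built from the rounds `lo, …, t - 1`. -/
def feasible {d L : ℕ} (M R ρ δ : ℝ) (A : ℕ → Vec d) (I : ℕ → Fin (L + 1)) (X : ℕ → ℝ)
    (lo t : ℕ) (S : Finset (Fin L)) (a : Vec d) (ϑ : Fin (L + 1) → Vec d) : Prop :=
  a ∈ Metric.closedBall (0 : Vec d) 1 ∧
    ∀ j ∈ coreIndices S, ϑ j ∈ confSet M R ρ δ A X (queried I j lo t)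

/-- The width `‖a‖_{V_j⁻¹} √(β_{T_j}(δ))` of the `j`-th ellipsoid in the direction `a`. -/
def width {d L : ℕ} (M R ρ δ : ℝ) (A : ℕ → Vec d) (I : ℕ → Fin (L + 1))
    (lo t : ℕ) (a : Vec d) (j : Fin (L + 1)) : ℝ :=
  weightedNorm (design ρ A (queried I j lo t))⁻¹ a * sqrtBeta d M R ρ δ (queried I j lo t).card

/-- Round `t` is an optimistic round: the action is (the first component of) a maximiser of the
objective over all feasible pairs, and the query is a least explored index of `{0} ∪ S`. -/
def optimisticRound {d L : ℕ} (M R ρ δ : ℝ) (A : ℕ → Vec d) (I : ℕ → Fin (L + 1)) (X : ℕ → ℝ)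
    (lo t : ℕ) (S : Finset (Fin L)) : Prop :=
  (∃ ϑ : Fin (L + 1) → Vec d, feasible M R ρ δ A I X lo t S (A t) ϑ ∧
    ∀ (a : Vec d) (ϑ' : Fin (L + 1) → Vec d), feasible M R ρ δ A I X lo t S a ϑ' →
      value S a ϑ' ≤ value S (A t) ϑ) ∧
  I t ∈ coreIndices S ∧
  ∀ j ∈ coreIndices S, width M R ρ δ A I lo t (A t) j ≤ width M R ρ δ A I lo t (A t) (I t)

/-- The actions `A`, queried indices `I` and feedbacks `X` of the first `T` rounds are those of a
run of Protected LinUCB. CORE-SET is run at confidence level `δ / (2 L)` with regulariser `ρ₀`; the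
ellipsoids of the optimistic phase have level `δ / (2 (L + 1))` and regulariser `ρ`, and are built
from the data of the optimistic phase (`V_j` is reset to `ρ I` when that phase starts). -/
def isProtectedLinUCB {d L : ℕ} (s : ℕ) (M R ρ ρ₀ δ : ℝ) (T : ℕ)
    (A : ℕ → Vec d) (I : ℕ → Fin (L + 1)) (X : ℕ → ℝ) : Prop :=
  (∀ (n : ℕ) (i : Fin d) (p : Fin L), n * (d * L) + i * L + p < T →
    (∀ m ≤ n, coreContinue s M R ρ₀ (δ / (2 * L)) A I X m) →
      A (n * (d * L) + i * L + p) = EuclideanSpace.single i 1 ∧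
      I (n * (d * L) + i * L + p) = p.succ) ∧
  (∀ n : ℕ, coreEnds s M R ρ₀ (δ / (2 * L)) A I X n →
    ∃ S : Finset (Fin L), isCoreSet s ρ₀ A I X n S ∧
      ∀ t : ℕ, n * (d * L) ≤ t → t < T →
        optimisticRound M R ρ (δ / (2 * (L + 1))) A I X (n * (d * L)) t S)

/-! ### Environment and regret -/

/-- `θ_⊥`, the projection of `θ_0` onto the orthogonal complement of the protected subspace. -/
def thetaPerp {d L : ℕ} (θ : Fin (L + 1) → Vec d) : Vec d :=
  projPerp (Set.range fun p : Fin L => θ p.succ) (θ 0)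

/-- The pseudo-regret `∑_{t < T} ⟨a⋆ - A_t, θ_⊥⟩` of the first `T` rounds. -/
def regret {d L : ℕ} (θ : Fin (L + 1) → Vec d) (aStar : Vec d) (A : ℕ → Vec d) (T : ℕ) : ℝ :=
  ∑ t ∈ Finset.range T, ⟪aStar - A t, thetaPerp θ⟫_ℝ

/-- `(A_t, I_t)` is chosen on the basis of the past `ℱ_t`, and the noise `η_t` added to the feedback
of round `t` is conditionally centred and `R`-subgaussian given `ℱ_t`. -/
structure IsBanditNoise {Ω : Type*} {mΩ : MeasurableSpace Ω} (P : Measure Ω) (R : ℝ) {d L : ℕ}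
    (ℱ : Filtration ℕ mΩ) (A : ℕ → Ω → Vec d) (I : ℕ → Ω → Fin (L + 1)) (η : ℕ → Ω → ℝ) :
    Prop where
  action_meas : ∀ t, Measurable[ℱ t] (A t)
  index_meas : ∀ t, Measurable[ℱ t] (I t)
  noise_meas : ∀ t, Measurable[ℱ (t + 1)] (η t)
  centred : ∀ t, P[η t | ℱ t] =ᵐ[P] 0
  exp_integrable : ∀ t (l : ℝ), Integrable (fun ω => Real.exp (l * η t ω)) P
  subgaussian : ∀ t (l : ℝ),
    P[fun ω => Real.exp (l * η t ω) | ℱ t] ≤ᵐ[P] fun _ => Real.exp (l ^ 2 * R ^ 2 / 2)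

end ProtectedBandit

end

/-! The proof combines optimism with a perturbation argument for the smallest singular value, on an
event of probability at least `1 - δ`.

Optimistic rounds (`instant_regret_le`). If every true vector lies in its ellipsoid, the optimistic
value dominates the optimal one. When nonzero, the optimistic residual `q` is parallel to the chosen
action `a`, so `a` is orthogonal to all optimistic protected vectors `ϑ_i`, and the optimistic value
is `⟨a, ϑ_0⟩`. The regret is therefore at most `⟨a, ϑ_0 - θ_0⟩ + ⟨a, θ_0 - θ_⊥⟩`. Writing `θ_0 - θ_⊥
= ∑ x_i θ_i` over the core set, the second term equals `∑ x_i ⟨a, θ_i - ϑ_i⟩`, and `‖x‖` is at most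
the reciprocal of the smallest singular value of the core set. Thus the regret is at most `√s / √λ_S
+ 1` times the largest estimation error along `a`. Since the widest ellipsoid is the one queried,
the errors are summed by the elliptical potential argument, applied to `s + 1` design matrices at
once (`sum_log_one_add_weightedNorm`, `sum_le_of_sum_log_le`).

CORE-SET. The map `v ↦ √(lamMin v S)` is Lipschitz (`sqrt_lamMin_le_add`). At the stopping time the
estimation error is small relative to the threshold, so the selected set has `√λ_S` within a factor
3 of the best (`sqrt_lamMin_coreSet_le`). The loop cannot continue once the threshold is well below
`λ_min`, which bounds the number of passes by `(48 L W / λ_min)^2` with `W = d log 6 + log (2L/δ)`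
(`core_length_le`). A pass has `d L` rounds of regret at most 2, which gives the constant `4608 = 2
· 48^2`.

Concentration. Both phases use the self-normalised bound `measure_selfNormalized_le`, obtained by
Gaussian mixtures and a maximal inequality for nonnegative supermartingales. It is applied to
predictable actions set to zero outside the rounds of interest: the fixed CORE-SET schedule for each
protected vector, and the optimistic queries of each index. The end of CORE-SET is described through
the noise alone, so that these actions are adapted. A union bound over `L` and `L + 1` events, each
family costing `δ / 2`, completes the proof. -/

noncomputable section

namespace ProtectedBandit

/-! ### Weighted norms and determinants of design matrices. -/

section WeightedNorm

variable {d : ℕ}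

theorem inner_eq_dotProduct (x y : Vec d) : ⟪x, y⟫_ℝ = x.ofLp ⬝ᵥ y.ofLp := by
  rw [EuclideanSpace.inner_eq_star_dotProduct, star_trivial, dotProduct_comm]

theorem norm_sq_eq_dotProduct (x : Vec d) : ‖x‖ ^ 2 = x.ofLp ⬝ᵥ x.ofLp := by
  rw [← real_inner_self_eq_norm_sq, inner_eq_dotProduct]

theorem outer_mulVec (x : Vec d) (y : Fin d → ℝ) : outer x *ᵥ y = (x.ofLp ⬝ᵥ y) • x.ofLp := by
  rw [outer, Matrix.vecMulVec_mulVec]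
  ext i
  simp [mul_comm]

theorem outer_posSemidef (x : Vec d) : (outer x).PosSemidef := by
  simpa [outer] using Matrix.posSemidef_vecMulVec_self_star x.ofLp

theorem design_posDef (A : ℕ → Vec d) (U : Finset ℕ) : (design 1 A U).PosDef := by
  rw [design, one_smul]
  exact Matrix.PosDef.one.add_posSemidef
    (Matrix.posSemidef_sum _ fun u _ => outer_posSemidef (A u))

-- With `V = Bᵀ B`, the weighted norm of `x` is the Euclidean norm of `B x`, and that of `V⁻¹` comes
-- from the inverse transpose of `B`; norm inequalities then reduce to Euclidean ones.
open scoped MatrixOrder in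
theorem exists_transpose_mul_self {V : Matrix (Fin d) (Fin d) ℝ} (hV : V.PosDef) :
    ∃ B : Matrix (Fin d) (Fin d) ℝ, B.det ≠ 0 ∧ V = Bᵀ * B := by
  have h0 : 0 ≤ V := Matrix.nonneg_iff_posSemidef.mpr hV.posSemidef
  obtain ⟨B, hB⟩ := CStarAlgebra.nonneg_iff_eq_star_mul_self.mp h0
  have hB' : V = Bᵀ * B := by
    rw [hB, Matrix.star_eq_conjTranspose, Matrix.conjTranspose_eq_transpose_of_trivial]
  refine ⟨B, fun h => hV.det_pos.ne' ?_, hB'⟩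
  rw [hB', Matrix.det_mul, h, mul_zero]

theorem weightedNorm_transpose_mul_self (B : Matrix (Fin d) (Fin d) ℝ) (x : Vec d) :
    weightedNorm (Bᵀ * B) x = ‖(WithLp.toLp 2 (B *ᵥ x.ofLp) : Vec d)‖ := by
  rw [weightedNorm, ← Matrix.mulVec_mulVec, Matrix.dotProduct_mulVec, Matrix.vecMul_transpose,
    ← Real.sqrt_sq (norm_nonneg _), norm_sq_eq_dotProduct]

theorem inv_transpose_mul_self (B : Matrix (Fin d) (Fin d) ℝ) :
    (Bᵀ * B)⁻¹ = ((B⁻¹)ᵀ)ᵀ * (B⁻¹)ᵀ := by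
  rw [Matrix.mul_inv_rev, Matrix.transpose_transpose, Matrix.transpose_nonsing_inv]

theorem weightedNorm_nonneg (V : Matrix (Fin d) (Fin d) ℝ) (x : Vec d) : 0 ≤ weightedNorm V x :=
  Real.sqrt_nonneg _

theorem weightedNorm_sq {V : Matrix (Fin d) (Fin d) ℝ} (hV : V.PosSemidef) (x : Vec d) :
    weightedNorm V x ^ 2 = x.ofLp ⬝ᵥ (V *ᵥ x.ofLp) :=
  Real.sq_sqrt (by simpa using hV.dotProduct_mulVec_nonneg x.ofLp)

theorem weightedNorm_add_le {V : Matrix (Fin d) (Fin d) ℝ} (hV : V.PosDef) (x y : Vec d) :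
    weightedNorm V (x + y) ≤ weightedNorm V x + weightedNorm V y := by
  obtain ⟨B, -, rfl⟩ := exists_transpose_mul_self hV
  simp only [weightedNorm_transpose_mul_self, WithLp.ofLp_add, Matrix.mulVec_add, WithLp.toLp_add]
  exact norm_add_le _ _

theorem weightedNorm_neg (V : Matrix (Fin d) (Fin d) ℝ) (x : Vec d) :
    weightedNorm V (-x) = weightedNorm V x := by
  simp [weightedNorm, Matrix.mulVec_neg]

theorem weightedNorm_sub_le {V : Matrix (Fin d) (Fin d) ℝ} (hV : V.PosDef) (x y : Vec d) :
    weightedNorm V (x - y) ≤ weightedNorm V x + weightedNorm V y := by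
  rw [sub_eq_add_neg, ← weightedNorm_neg V y]
  exact weightedNorm_add_le hV _ _

theorem inner_le_weightedNorm_mul {V : Matrix (Fin d) (Fin d) ℝ} (hV : V.PosDef) (a y : Vec d) :
    ⟪a, y⟫_ℝ ≤ weightedNorm V⁻¹ a * weightedNorm V y := by
  obtain ⟨B, hB, rfl⟩ := exists_transpose_mul_self hV
  rw [inv_transpose_mul_self, weightedNorm_transpose_mul_self, weightedNorm_transpose_mul_self]
  refine le_trans (le_of_eq ?_) (real_inner_le_norm _ _)
  rw [inner_eq_dotProduct, inner_eq_dotProduct, Matrix.mulVec_transpose,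
    ← Matrix.dotProduct_mulVec, Matrix.mulVec_mulVec,
    Matrix.nonsing_inv_mul _ (isUnit_iff_ne_zero.mpr hB), Matrix.one_mulVec]

theorem weightedNorm_inv_mulVec {V : Matrix (Fin d) (Fin d) ℝ} (hV : V.PosDef) (x : Vec d) :
    weightedNorm V (WithLp.toLp 2 (V⁻¹ *ᵥ x.ofLp)) = weightedNorm V⁻¹ x := by
  rw [weightedNorm, weightedNorm]
  congr 1
  rw [Matrix.mulVec_mulVec, Matrix.mul_nonsing_inv _ (isUnit_iff_ne_zero.mpr hV.det_pos.ne'),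
    Matrix.one_mulVec, dotProduct_comm]

theorem norm_le_weightedNorm {V : Matrix (Fin d) (Fin d) ℝ} (hV : (V - 1).PosSemidef)
    (x : Vec d) : ‖x‖ ≤ weightedNorm V x := by
  rw [weightedNorm]
  refine Real.le_sqrt_of_sq_le ?_
  have h := hV.dotProduct_mulVec_nonneg x.ofLp
  rw [star_trivial, Matrix.sub_mulVec, dotProduct_sub, Matrix.one_mulVec] at h
  rw [norm_sq_eq_dotProduct]
  linarith

/-- With `y = V⁻¹ x`, Cauchy-Schwarz and `‖y‖ ≤ ‖y‖_V` give `‖x‖²_{V⁻¹} = ⟨x, y⟩ ≤ ‖x‖ ‖y‖_V = ‖x‖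
‖x‖_{V⁻¹}`. -/
theorem weightedNorm_inv_le_norm {V : Matrix (Fin d) (Fin d) ℝ} (hV : V.PosDef)
    (hV' : (V - 1).PosSemidef) (x : Vec d) : weightedNorm V⁻¹ x ≤ ‖x‖ := by
  have h1 := norm_le_weightedNorm hV' (WithLp.toLp 2 (V⁻¹ *ᵥ x.ofLp))
  rw [weightedNorm_inv_mulVec hV] at h1
  have h2 : weightedNorm V⁻¹ x ^ 2 ≤ ‖x‖ * weightedNorm V⁻¹ x := by
    rw [weightedNorm_sq hV.inv.posSemidef, ← inner_eq_dotProduct x (WithLp.toLp 2 (V⁻¹ *ᵥ x.ofLp))]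
    exact (real_inner_le_norm _ _).trans (mul_le_mul_of_nonneg_left h1 (norm_nonneg _))
  by_contra! h
  have := (norm_nonneg x).trans_lt h
  nlinarith

theorem design_sub_one_posSemidef (A : ℕ → Vec d) (U : Finset ℕ) :
    (design 1 A U - 1).PosSemidef := by
  rw [design, one_smul, add_sub_cancel_left]
  exact Matrix.posSemidef_sum _ fun u _ => outer_posSemidef (A u)

theorem det_add_outer {V : Matrix (Fin d) (Fin d) ℝ} (hV : V.PosDef) (a : Vec d) :
    (V + outer a).det = V.det * (1 + weightedNorm V⁻¹ a ^ 2) := by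
  rw [weightedNorm_sq hV.inv.posSemidef, outer, Matrix.vecMulVec_eq Unit,
    Matrix.det_add_replicateCol_mul_replicateRow (isUnit_iff_ne_zero.mpr hV.det_pos.ne')]
  congr 1
  rw [Matrix.det_unique, Matrix.add_apply, Matrix.one_apply_eq, Matrix.mul_assoc,
    ← Matrix.replicateCol_mulVec]
  rfl

theorem design_insert (A : ℕ → Vec d) {U : Finset ℕ} {u : ℕ} (hu : u ∉ U) :
    design 1 A (insert u U) = design 1 A U + outer (A u) := by
  rw [design, design, Finset.sum_insert hu]
  abel

theorem trace_outer (x : Vec d) : (outer x).trace = ‖x‖ ^ 2 := by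
  rw [outer, Matrix.trace_vecMulVec, norm_sq_eq_dotProduct]

/-- This is the inequality of arithmetic and geometric means for the eigenvalues. -/
theorem det_le_trace_div_pow (hd : 0 < d) {V : Matrix (Fin d) (Fin d) ℝ} (hV : V.PosDef) :
    V.det ≤ (V.trace / d) ^ d := by
  have hd' : (0 : ℝ) < d := by exact_mod_cast hd
  have h := Real.geom_mean_le_arith_mean Finset.univ (fun _ : Fin d => (1 : ℝ))
    hV.isHermitian.eigenvalues (fun _ _ => zero_le_one) (by simpa using hd)
    (fun i _ => (hV.eigenvalues_pos i).le)
  simp only [Real.rpow_one, Finset.sum_const, Finset.card_univ, Fintype.card_fin, nsmul_eq_mul,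
    mul_one, one_mul] at h
  have h1 := hV.isHermitian.det_eq_prod_eigenvalues
  have h2 := hV.isHermitian.trace_eq_sum_eigenvalues
  simp only [RCLike.ofReal_real_eq_id, id] at h1 h2
  rw [← h1, ← h2] at h
  have h0 := hV.det_pos
  calc V.det = (V.det ^ ((d : ℝ)⁻¹)) ^ d := by
        rw [← Real.rpow_natCast, ← Real.rpow_mul h0.le, inv_mul_cancel₀ hd'.ne', Real.rpow_one]
    _ ≤ _ := pow_le_pow_left₀ (by positivity) h d

theorem log_det_design_le (hd : 0 < d) (A : ℕ → Vec d) (U : Finset ℕ)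
    (hA : ∀ u ∈ U, ‖A u‖ ≤ 1) :
    Real.log (design 1 A U).det ≤ d * Real.log (1 + U.card / d) := by
  have hd' : (0 : ℝ) < d := by exact_mod_cast hd
  have hV := design_posDef A U
  have htr : (design 1 A U).trace ≤ d + U.card := by
    rw [design, one_smul, Matrix.trace_add, Matrix.trace_one, Matrix.trace_sum, Fintype.card_fin]
    refine add_le_add le_rfl ?_
    refine (Finset.sum_le_card_nsmul U _ 1 fun u hu => ?_).trans (by simp)
    rw [trace_outer]
    exact pow_le_one₀ (norm_nonneg _) (hA u hu)
  have : Nonempty (Fin d) := ⟨⟨0, hd⟩⟩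
  have htr0 : 0 < (design 1 A U).trace := hV.trace_pos
  rw [← Real.log_pow]
  refine Real.log_le_log hV.det_pos ((det_le_trace_div_pow hd hV).trans ?_)
  refine pow_le_pow_left₀ (by positivity) ?_ d
  rw [div_le_iff₀ hd', add_mul, one_mul, div_mul_cancel₀ _ hd'.ne']
  exact htr

end WeightedNorm

/-! ### Gaussian integrals with a quadratic form. -/

section Gaussian

variable {d : ℕ}

/-- The normalising constant of the Gaussian integrals below. -/
def gaussConst (d : ℕ) : ENNReal :=
  ∫⁻ x : Vec d, ENNReal.ofReal (Real.exp (-(1 / 2) * ‖x‖ ^ 2))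

theorem gaussConst_ne_zero : gaussConst d ≠ 0 := by
  rw [gaussConst, Ne, lintegral_eq_zero_iff (by fun_prop)]
  intro h
  have h2 : ∀ᵐ x : Vec d, False := by
    filter_upwards [h] with x hx
    simp only [Pi.zero_apply, ENNReal.ofReal_eq_zero] at hx
    exact absurd hx (not_le.mpr (Real.exp_pos _))
  exact NeZero.ne (volume : Measure (Vec d)) (by simpa using h2)

theorem gaussConst_ne_top : gaussConst d ≠ ⊤ := by
  have h := (GaussianFourier.integrable_cexp_neg_mul_sq_norm_add (V := Vec d)
    (b := (1 / 2 : ℂ)) (by norm_num) 0 0).norm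
  have h2 : Integrable (fun x : Vec d => Real.exp (-(1 / 2) * ‖x‖ ^ 2)) := by
    refine h.congr (Filter.Eventually.of_forall fun x => ?_)
    simp only [Complex.norm_exp]
    congr 1
    simp [← Complex.ofReal_pow]
  exact h2.lintegral_lt_top.ne

/-- Factor `V = Bᵀ B`, complete the square around `z = (B⁻¹)ᵀ S` and substitute `y = B x`; the
Jacobian `|det B|⁻¹` is `exp (-½ log det V)`. The normalising constant is left unevaluated since it
cancels later. -/
theorem lintegral_gaussian {V : Matrix (Fin d) (Fin d) ℝ} (hV : V.PosDef) (S : Vec d) :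
    ∫⁻ x : Vec d, ENNReal.ofReal
        (Real.exp (⟪x, S⟫_ℝ - 1 / 2 * (x.ofLp ⬝ᵥ (V *ᵥ x.ofLp)))) =
      ENNReal.ofReal (Real.exp (1 / 2 * weightedNorm V⁻¹ S ^ 2 - 1 / 2 * Real.log V.det)) *
        gaussConst d := by
  obtain ⟨B, hB, rfl⟩ := exists_transpose_mul_self hV
  set f : Vec d →ₗ[ℝ] Vec d := Matrix.toLpLin 2 2 B with hf
  have hdet : LinearMap.det f = B.det := by
    rw [← LinearMap.det_toLin' B, hf, ← LinearMap.det_conj (Matrix.toLin' B)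
      (WithLp.linearEquiv 2 ℝ (Fin d → ℝ)).symm]
    rfl
  have hmap := Measure.map_linearMap_addHaar_eq_smul_addHaar (volume : Measure (Vec d))
    (f := f) (by rw [hdet]; exact hB)
  set z : Vec d := WithLp.toLp 2 ((B⁻¹)ᵀ *ᵥ S.ofLp) with hz
  have hfm : Measurable f := (LinearMap.continuous_of_finiteDimensional f).measurable
  have hkey : ∀ x : Vec d, ⟪x, S⟫_ℝ - 1 / 2 * (x.ofLp ⬝ᵥ ((Bᵀ * B) *ᵥ x.ofLp)) =
      1 / 2 * weightedNorm (Bᵀ * B)⁻¹ S ^ 2 + -(1 / 2) * ‖f x - z‖ ^ 2 := by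
    intro x
    have h1 : weightedNorm (Bᵀ * B)⁻¹ S = ‖z‖ := by
      rw [inv_transpose_mul_self, weightedNorm_transpose_mul_self]
    have h2 : x.ofLp ⬝ᵥ ((Bᵀ * B) *ᵥ x.ofLp) = ‖f x‖ ^ 2 := by
      rw [← weightedNorm_sq hV.posSemidef, weightedNorm_transpose_mul_self]
      rfl
    have h3 : ⟪x, S⟫_ℝ = ⟪f x, z⟫_ℝ := by
      rw [inner_eq_dotProduct, inner_eq_dotProduct, hz]
      change _ = (B *ᵥ x.ofLp) ⬝ᵥ _
      rw [dotProduct_comm _ ((B⁻¹)ᵀ *ᵥ _), Matrix.mulVec_transpose,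
        ← Matrix.dotProduct_mulVec, Matrix.mulVec_mulVec,
        Matrix.nonsing_inv_mul _ (isUnit_iff_ne_zero.mpr hB), Matrix.one_mulVec, dotProduct_comm]
    rw [h1, h2, h3, norm_sub_sq_real]
    ring
  simp_rw [hkey, Real.exp_add, ENNReal.ofReal_mul (Real.exp_pos _).le]
  rw [lintegral_const_mul _ (by fun_prop)]
  have h4 : ∫⁻ x : Vec d, ENNReal.ofReal (Real.exp (-(1 / 2) * ‖f x - z‖ ^ 2)) =
      ENNReal.ofReal |B.det⁻¹| * gaussConst d := by
    rw [← lintegral_map (μ := volume) (g := f)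
      (f := fun y => ENNReal.ofReal (Real.exp (-(1 / 2) * ‖y - z‖ ^ 2))) (by fun_prop) hfm, hmap,
      lintegral_smul_measure, hdet, smul_eq_mul,
      lintegral_sub_right_eq_self (fun y : Vec d =>
        ENNReal.ofReal (Real.exp (-(1 / 2) * ‖y‖ ^ 2))) z]
    rfl
  rw [h4, ← mul_assoc, ← ENNReal.ofReal_mul (Real.exp_pos _).le]
  congr 2
  rw [sub_eq_add_neg, Real.exp_add]
  congr 1
  rw [Matrix.det_mul, Matrix.det_transpose, abs_inv, ← sq, ← sq_abs, Real.log_pow]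
  push_cast
  rw [show -(1 / 2 * (2 * Real.log |B.det|)) = -Real.log |B.det| by ring, Real.exp_neg,
    Real.exp_log (abs_pos.mpr hB)]

end Gaussian

/-! ### The variational description of `lamMin` and its stability. -/

section LamMin

variable {d : ℕ} {ι : Type*}

/-- The synthesis map `x ↦ ∑ i ∈ S, x_i v_i`. -/
def synth (v : ι → Vec d) (S : Finset ι) : EuclideanSpace ℝ S →ₗ[ℝ] Vec d where
  toFun x := ∑ i : S, x i • v i
  map_add' x y := by simp [add_smul, Finset.sum_add_distrib]
  map_smul' c x := by simp [mul_smul, Finset.smul_sum]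

/-- The analysis map `w ↦ (⟨v_i, w⟩)_{i ∈ S}`, the adjoint of `synth`. -/
def analysis (v : ι → Vec d) (S : Finset ι) : Vec d →ₗ[ℝ] EuclideanSpace ℝ S where
  toFun w := WithLp.toLp 2 fun i : S => ⟪v i, w⟫_ℝ
  map_add' x y := by ext i; simp [inner_add_right]
  map_smul' c x := by ext i; simp [inner_smul_right]

theorem synth_apply (v : ι → Vec d) (S : Finset ι) (x : EuclideanSpace ℝ S) :
    synth v S x = ∑ i : S, x i • v i := rfl

theorem inner_analysis (v : ι → Vec d) (S : Finset ι) (w : Vec d) (x : EuclideanSpace ℝ S) :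
    ⟪analysis v S w, x⟫_ℝ = ⟪w, synth v S x⟫_ℝ := by
  rw [synth_apply, inner_sum, PiLp.inner_apply]
  refine Finset.sum_congr rfl fun i _ => ?_
  rw [inner_smul_right, real_inner_comm (v i)]
  simp [analysis]

theorem sum_outer_mulVec (v : ι → Vec d) (S : Finset ι) (w : Vec d) :
    (∑ i ∈ S, outer (v i)) *ᵥ w.ofLp = (synth v S (analysis v S w)).ofLp := by
  rw [Matrix.sum_mulVec, synth_apply, WithLp.ofLp_sum,
    ← Finset.sum_coe_sort S fun i => outer (v i) *ᵥ w.ofLp]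
  refine Finset.sum_congr rfl fun i _ => ?_
  rw [outer_mulVec, ← inner_eq_dotProduct]
  rfl

theorem lamMin_of_not_linearIndependent {v : ι → Vec d} {S : Finset ι}
    (h : ¬ LinearIndependent ℝ fun i : S => v i) : lamMin v S = 0 :=
  if_neg h

theorem synth_ne_zero {v : ι → Vec d} {S : Finset ι}
    (h : LinearIndependent ℝ fun i : S => v i) {x : EuclideanSpace ℝ S} (hx : x ≠ 0) :
    synth v S x ≠ 0 := fun h0 => hx <| by
  ext i
  exact Fintype.linearIndependent_iff.mp h x.ofLp h0 i

/-- The matrix `∑ v_i v_iᵀ` is `synth ∘ analysis`, and it has the same nonzero eigenvalues as the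
Gram operator `analysis ∘ synth` on coefficients. Under independence the Gram operator is positive
definite, so its least eigenvalue is the minimum of the Rayleigh quotient `‖synth x‖² / ‖x‖²`. -/
theorem exists_lamMin_of_linearIndependent {v : ι → Vec d} {S : Finset ι} (hS : S.Nonempty)
    (h : LinearIndependent ℝ fun i : S => v i) :
    0 < lamMin v S ∧ (∀ x, lamMin v S * ‖x‖ ^ 2 ≤ ‖synth v S x‖ ^ 2) ∧
      ∃ x, x ≠ 0 ∧ ‖synth v S x‖ ^ 2 = lamMin v S * ‖x‖ ^ 2 := by
  have : Nonempty S := hS.to_subtype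
  set T : EuclideanSpace ℝ S →ₗ[ℝ] EuclideanSpace ℝ S := analysis v S ∘ₗ synth v S with hT
  have hTx : ∀ x y, ⟪T x, y⟫_ℝ = ⟪synth v S x, synth v S y⟫_ℝ := fun x y =>
    inner_analysis v S _ y
  have hsymm : T.IsSymmetric := fun x y => by
    rw [hTx, ← real_inner_comm x (T y), hTx, real_inner_comm]
  obtain ⟨μ, hμdef⟩ : ∃ μ : ℝ, μ = ⨅ x : { x : EuclideanSpace ℝ S // x ≠ 0 },
      RCLike.re ⟪T x, (x : EuclideanSpace ℝ S)⟫_ℝ / ‖(x : EuclideanSpace ℝ S)‖ ^ 2 := ⟨_, rfl⟩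
  have hev := hsymm.hasEigenvalue_iInf_of_finiteDimensional
  rw [← hμdef] at hev
  obtain ⟨x₀, hx₀⟩ := hev.exists_hasEigenvector
  have hTx₀ : T x₀ = μ • x₀ := hx₀.apply_eq_smul
  have hmin : ∀ x, μ * ‖x‖ ^ 2 ≤ ‖synth v S x‖ ^ 2 := by
    intro x
    by_cases hx : x = 0
    · simp [hx]
    have hbdd : BddBelow (Set.range fun x : { x : EuclideanSpace ℝ S // x ≠ 0 } =>
        RCLike.re ⟪T x, (x : EuclideanSpace ℝ S)⟫_ℝ / ‖(x : EuclideanSpace ℝ S)‖ ^ 2) := by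
      refine ⟨0, ?_⟩
      rintro _ ⟨y, rfl⟩
      simp only [hTx, real_inner_self_eq_norm_sq, RCLike.re_to_real]
      positivity
    have h1 := ciInf_le hbdd ⟨x, hx⟩
    rw [← hμdef] at h1
    simp only [hTx, real_inner_self_eq_norm_sq, RCLike.re_to_real] at h1
    rwa [le_div_iff₀ (by positivity)] at h1
  have hatt : ‖synth v S x₀‖ ^ 2 = μ * ‖x₀‖ ^ 2 := by
    rw [← real_inner_self_eq_norm_sq, ← hTx, hTx₀, inner_smul_left, real_inner_self_eq_norm_sq]
    rfl
  have hne := synth_ne_zero h hx₀.2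
  have hμ : 0 < μ := by
    have : 0 < μ * ‖x₀‖ ^ 2 := hatt ▸ by positivity
    exact pos_of_mul_pos_left this (by positivity)
  have hlam : lamMin v S = μ := by
    rw [lamMin, if_pos h]
    refine IsLeast.csInf_eq ⟨⟨hμ.ne', ?_⟩, ?_⟩
    · refine Module.End.hasEigenvalue_of_hasEigenvector (x := (synth v S x₀).ofLp)
        (Module.End.hasEigenvector_iff.mpr ⟨Module.End.mem_eigenspace_iff.mpr ?_, ?_⟩)
      · rw [Matrix.toLin'_apply, sum_outer_mulVec]
        change (synth v S (T x₀)).ofLp = _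
        rw [hTx₀, map_smul, WithLp.ofLp_smul]
      · simpa using hne
    -- For an eigenvector `w` with eigenvalue `y ≠ 0`, the coefficient vector `analysis w` is
    -- nonzero and has Rayleigh quotient `y`, hence `μ ≤ y`.
    · rintro y ⟨hy0, hy⟩
      obtain ⟨w, hw⟩ := hy.exists_hasEigenvector
      have hw1 := hw.apply_eq_smul
      set w' : Vec d := WithLp.toLp 2 w with hw'
      have hw2 : synth v S (analysis v S w') = y • w' := by
        have h3 := sum_outer_mulVec v S w'
        rw [Matrix.toLin'_apply] at hw1
        rw [hw'] at h3 ⊢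
        ext i
        rw [← h3]
        exact congrFun hw1 i
      have hw0 : analysis v S w' ≠ 0 := by
        intro h0
        rw [h0, map_zero] at hw2
        have hw3 : w' = 0 := (smul_eq_zero.mp hw2.symm).resolve_left hy0
        exact hw.2 (by simpa [hw'] using hw3)
      have h5 := hmin (analysis v S w')
      have h6 : ‖synth v S (analysis v S w')‖ ^ 2 = y * ‖analysis v S w'‖ ^ 2 := by
        rw [← real_inner_self_eq_norm_sq]
        nth_rewrite 1 [hw2]
        rw [inner_smul_left, ← inner_analysis, real_inner_self_eq_norm_sq]
        rfl
      rw [h6] at h5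
      exact le_of_mul_le_mul_right h5 (by positivity)
  rw [hlam]
  exact ⟨hμ, hmin, x₀, hx₀.2, hatt⟩

theorem lamMin_mul_le {v : ι → Vec d} {S : Finset ι} (hS : S.Nonempty) (x : EuclideanSpace ℝ S) :
    lamMin v S * ‖x‖ ^ 2 ≤ ‖synth v S x‖ ^ 2 := by
  by_cases h : LinearIndependent ℝ fun i : S => v i
  · exact (exists_lamMin_of_linearIndependent hS h).2.1 x
  · rw [lamMin_of_not_linearIndependent h, zero_mul]
    positivity

theorem lamMin_nonneg {v : ι → Vec d} {S : Finset ι} (hS : S.Nonempty) : 0 ≤ lamMin v S := by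
  by_cases h : LinearIndependent ℝ fun i : S => v i
  · exact (exists_lamMin_of_linearIndependent hS h).1.le
  · rw [lamMin_of_not_linearIndependent h]

theorem lamMin_pos_iff {v : ι → Vec d} {S : Finset ι} (hS : S.Nonempty) :
    0 < lamMin v S ↔ LinearIndependent ℝ fun i : S => v i := by
  refine ⟨fun h => ?_, fun h => (exists_lamMin_of_linearIndependent hS h).1⟩
  by_contra h'
  rw [lamMin_of_not_linearIndependent h'] at h
  exact lt_irrefl _ h

/-- For dependent vectors a normalised linear relation serves as minimiser, in agreement with the
value 0 of `lamMin`. The variational description is thus valid without independence, which makes the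
perturbation bound uniform. -/
theorem exists_norm_eq_one_lamMin {v : ι → Vec d} {S : Finset ι} (hS : S.Nonempty) :
    ∃ x : EuclideanSpace ℝ S, ‖x‖ = 1 ∧ ‖synth v S x‖ = √(lamMin v S) := by
  obtain ⟨x, hx, h⟩ : ∃ x : EuclideanSpace ℝ S, x ≠ 0 ∧
      ‖synth v S x‖ ^ 2 = lamMin v S * ‖x‖ ^ 2 := by
    by_cases h : LinearIndependent ℝ fun i : S => v i
    · exact (exists_lamMin_of_linearIndependent hS h).2.2
    · obtain ⟨g, hg, i, hi⟩ := Fintype.not_linearIndependent_iff.mp h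
      refine ⟨WithLp.toLp 2 g, fun h0 => hi ?_, ?_⟩
      · simpa using congrArg (fun y : EuclideanSpace ℝ S => y i) h0
      · rw [lamMin_of_not_linearIndependent h, synth_apply, zero_mul]
        change ‖∑ i, g i • v i‖ ^ 2 = 0
        rw [hg, norm_zero, zero_pow two_ne_zero]
  have hx' : ‖x‖ ≠ 0 := norm_ne_zero_iff.mpr hx
  refine ⟨‖x‖⁻¹ • x, by rw [norm_smul, norm_inv, norm_norm, inv_mul_cancel₀ hx'], ?_⟩
  rw [map_smul, norm_smul, norm_inv, norm_norm, ← Real.sqrt_sq (norm_nonneg (synth v S x)), h,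
    Real.sqrt_mul (lamMin_nonneg hS), Real.sqrt_sq (norm_nonneg x)]
  field_simp

theorem sum_abs_le_sqrt_card_mul_norm {S : Finset ι} (x : EuclideanSpace ℝ S) :
    ∑ i, |x i| ≤ √S.card * ‖x‖ := by
  rw [EuclideanSpace.norm_eq, ← Real.sqrt_mul (Nat.cast_nonneg _)]
  refine Real.le_sqrt_of_sq_le ?_
  have h := sq_sum_le_card_mul_sum_sq (s := Finset.univ) (f := fun i => |x i|)
  simpa using h

/-- The singular value `√λ_min` is Lipschitz in the vectors. -/
theorem sqrt_lamMin_le_add {v w : ι → Vec d} {S : Finset ι} (hS : S.Nonempty) {e : ℝ}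
    (he : ∀ i ∈ S, ‖v i - w i‖ ≤ e) :
    √(lamMin v S) ≤ √(lamMin w S) + √S.card * e := by
  obtain ⟨x, hx1, hx⟩ := exists_norm_eq_one_lamMin (v := w) hS
  have he0 : 0 ≤ e := by
    obtain ⟨i, hi⟩ := hS
    exact (norm_nonneg _).trans (he i hi)
  have h1 : √(lamMin v S) ≤ ‖synth v S x‖ := by
    have := lamMin_mul_le (v := v) hS x
    rw [hx1, one_pow, mul_one] at this
    exact Real.sqrt_le_iff.mpr ⟨norm_nonneg _, this⟩
  have h2 : ‖synth v S x - synth w S x‖ ≤ √S.card * e := by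
    rw [synth_apply, synth_apply, ← Finset.sum_sub_distrib]
    calc ‖∑ i : S, (x i • v i - x i • w i)‖ ≤ ∑ i : S, |x i| * e := by
          refine norm_sum_le_of_le _ fun i _ => ?_
          rw [← smul_sub, norm_smul, Real.norm_eq_abs]
          exact mul_le_mul_of_nonneg_left (he i i.2) (abs_nonneg _)
      _ ≤ _ := by
          rw [← Finset.sum_mul]
          have := sum_abs_le_sqrt_card_mul_norm x
          rw [hx1, mul_one] at this
          exact mul_le_mul_of_nonneg_right this he0
  calc √(lamMin v S) ≤ ‖synth v S x‖ := h1
    _ ≤ ‖synth w S x‖ + ‖synth v S x - synth w S x‖ := by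
        simpa using norm_add_le (synth w S x) (synth v S x - synth w S x)
    _ ≤ _ := by rw [hx]; gcongr

theorem lamMin_le_one {v : ι → Vec d} {S : Finset ι} (hS : S.Nonempty) (hv : ∀ i, ‖v i‖ ≤ 1) :
    lamMin v S ≤ 1 := by
  classical
  obtain ⟨i, hi⟩ := hS
  have h := lamMin_mul_le (v := v) ⟨i, hi⟩ (EuclideanSpace.single (⟨i, hi⟩ : S) 1)
  have h2 : synth v S (EuclideanSpace.single (⟨i, hi⟩ : S) 1) = v i := by
    rw [synth_apply, Finset.sum_eq_single ⟨i, hi⟩]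
    · simp
    · intro b _ hb; simp [hb]
    · simp
  rw [h2, PiLp.norm_single, norm_one, one_pow, mul_one] at h
  exact h.trans (pow_le_one₀ (norm_nonneg _) (hv i))

theorem lamMin_zero {S : Finset ι} (hS : S.Nonempty) : lamMin (fun _ : ι => (0 : Vec d)) S = 0 := by
  refine lamMin_of_not_linearIndependent fun h => ?_
  obtain ⟨i, hi⟩ := hS
  exact h.ne_zero ⟨i, hi⟩ rfl

/-- Continuity makes the stopping condition of CORE-SET a measurable event. -/
theorem continuous_lamMin {S : Finset ι} [Fintype ι] (hS : S.Nonempty) :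
    Continuous fun v : ι → Vec d => lamMin v S := by
  have h : LipschitzWith (Real.toNNReal (√S.card)) fun v : ι → Vec d => √(lamMin v S) := by
    refine LipschitzWith.of_le_add_mul _ fun v w => ?_
    rw [Real.coe_toNNReal _ (Real.sqrt_nonneg _)]
    refine sqrt_lamMin_le_add hS fun i _ => ?_
    rw [← dist_eq_norm]
    exact dist_le_pi_dist v w i
  have h2 : (fun v : ι → Vec d => lamMin v S) = fun v => √(lamMin v S) ^ 2 := by
    ext v; rw [Real.sq_sqrt (lamMin_nonneg hS)]
  rw [h2]
  exact h.continuous.pow 2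

end LamMin

/-! ### A maximal inequality for nonnegative supermartingales. -/

section SelfNormalized

variable {Ω : Type*} {mΩ : MeasurableSpace Ω} {P : Measure Ω} {ℱ : Filtration ℕ mΩ}

/-- A maximal inequality for nonnegative supermartingales. -/
theorem mul_measure_exists_le {M : ℕ → Ω → ENNReal} (hM : ∀ t, Measurable[ℱ t] (M t))
    (hsup : ∀ t B, MeasurableSet[ℱ t] B → ∫⁻ ω in B, M (t + 1) ω ∂P ≤ ∫⁻ ω in B, M t ω ∂P)
    (c : ENNReal) (n : ℕ) : c * P {ω | ∃ t ≤ n, c ≤ M t ω} ≤ ∫⁻ ω, M 0 ω ∂P := by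
  set D : ℕ → Set Ω := fun k => {ω | ∀ t ≤ k, M t ω < c} with hD
  have hDc : ∀ k, (D k)ᶜ = {ω | ∃ t ≤ k, c ≤ M t ω} := fun k => by
    ext ω; simp [hD]
  have hDm : ∀ k, MeasurableSet[ℱ k] (D k) := fun k => by
    have : D k = ⋂ t ∈ Set.Iic k, M t ⁻¹' Set.Iio c := by ext ω; simp [hD]
    rw [this]
    exact MeasurableSet.biInter (Set.to_countable _) fun t ht =>
      ℱ.mono ht _ (hM t measurableSet_Iio)
  have hmarkov : ∀ k (E : Set Ω), MeasurableSet[ℱ k] E → (∀ ω ∈ E, c ≤ M k ω) →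
      c * P E ≤ ∫⁻ ω in E, M k ω ∂P := fun k E hE h => by
    rw [← setLIntegral_const]
    exact setLIntegral_mono' (ℱ.le k _ hE) h
  -- Induction on a stopped version of the inequality: on `D k` the level `c` has not been reached
  -- and the mass is still carried by `M k`, while each first passage at time `k + 1` is charged by
  -- Markov's inequality.
  have key : ∀ k, c * P (D k)ᶜ + ∫⁻ ω in D k, M k ω ∂P ≤ ∫⁻ ω, M 0 ω ∂P := by
    intro k
    induction k with
    | zero =>
      rw [← lintegral_add_compl (μ := P) (M 0) (ℱ.le 0 _ (hDm 0)), add_comm]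
      refine add_le_add le_rfl (hmarkov 0 _ (hDm 0).compl fun ω hω => ?_)
      simpa [hD] using hω
    | succ k ih =>
      refine le_trans ?_ ih
      set E : Set Ω := D k \ D (k + 1) with hE
      have hsub : D (k + 1) ⊆ D k := fun ω hω t ht => hω t (ht.trans k.le_succ)
      have hEm : MeasurableSet[ℱ (k + 1)] E := (ℱ.mono k.le_succ _ (hDm k)).diff (hDm (k + 1))
      have h1 : P (D (k + 1))ᶜ ≤ P (D k)ᶜ + P E := by
        refine (measure_mono fun ω hω => ?_).trans (measure_union_le _ _)
        by_cases h : ω ∈ D k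
        · exact Or.inr ⟨h, hω⟩
        · exact Or.inl h
      have h2 : c * P E ≤ ∫⁻ ω in E, M (k + 1) ω ∂P := by
        refine hmarkov _ _ hEm fun ω hω => ?_
        by_contra! h
        refine hω.2 fun t ht => ?_
        rcases ht.lt_or_eq with h3 | rfl
        · exact hω.1 t (Nat.lt_succ_iff.mp h3)
        · exact h
      have h3 : ∫⁻ ω in D k, M (k + 1) ω ∂P =
          ∫⁻ ω in D (k + 1), M (k + 1) ω ∂P + ∫⁻ ω in E, M (k + 1) ω ∂P := by
        rw [← lintegral_union (ℱ.le _ _ hEm) Set.disjoint_sdiff_right, hE, Set.union_sdiff_cancel hsub]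
      calc c * P (D (k + 1))ᶜ + ∫⁻ ω in D (k + 1), M (k + 1) ω ∂P
          ≤ c * P (D k)ᶜ + c * P E + ∫⁻ ω in D (k + 1), M (k + 1) ω ∂P := by
            rw [← mul_add]; gcongr
        _ ≤ c * P (D k)ᶜ + ∫⁻ ω in E, M (k + 1) ω ∂P + ∫⁻ ω in D (k + 1), M (k + 1) ω ∂P := by
            gcongr
        _ = c * P (D k)ᶜ + ∫⁻ ω in D k, M (k + 1) ω ∂P := by rw [h3]; ring
        _ ≤ _ := add_le_add le_rfl (hsup k _ (hDm k))
  rw [← hDc]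
  exact le_self_add.trans (key n)

end SelfNormalized

/-! ### Exponential moments with predictable multipliers. -/

section Subgaussian

variable {Ω : Type*} {m mΩ : MeasurableSpace Ω} {P : Measure Ω}

theorem setLIntegral_exp_le [IsProbabilityMeasure P] (hm : m ≤ mΩ)
    {η : Ω → ℝ} (hint : ∀ l : ℝ, Integrable (fun ω => Real.exp (l * η ω)) P)
    (hsub : ∀ l : ℝ, P[fun ω => Real.exp (l * η ω) | m] ≤ᵐ[P] fun _ => Real.exp (l ^ 2 / 2))
    (l : ℝ) {B : Set Ω} (hB : MeasurableSet[m] B) :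
    ∫⁻ ω in B, ENNReal.ofReal (Real.exp (l * η ω - l ^ 2 / 2)) ∂P ≤ P B := by
  have h1 : ∫⁻ ω in B, ENNReal.ofReal (Real.exp (l * η ω)) ∂P ≤
      ENNReal.ofReal (Real.exp (l ^ 2 / 2)) * P B := by
    rw [← ofReal_integral_eq_lintegral_ofReal (hint l).integrableOn
      (Filter.Eventually.of_forall fun ω => (Real.exp_pos _).le), ← setIntegral_condExp hm (hint l) hB]
    have h2 : ∫ ω in B, (P[fun ω => Real.exp (l * η ω) | m]) ω ∂P ≤
        ∫ _ in B, Real.exp (l ^ 2 / 2) ∂P :=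
      integral_mono_ae integrable_condExp.integrableOn (integrable_const _)
        (ae_restrict_of_ae (hsub l))
    refine (ENNReal.ofReal_le_ofReal h2).trans (le_of_eq ?_)
    rw [setIntegral_const, smul_eq_mul, mul_comm, ENNReal.ofReal_mul (Real.exp_pos _).le,
      measureReal_def, ENNReal.ofReal_toReal (measure_ne_top _ _)]
  have h3 : ∀ ω, ENNReal.ofReal (Real.exp (l * η ω - l ^ 2 / 2)) =
      ENNReal.ofReal (Real.exp (-(l ^ 2 / 2))) * ENNReal.ofReal (Real.exp (l * η ω)) := fun ω => by
    rw [← ENNReal.ofReal_mul (Real.exp_pos _).le, ← Real.exp_add]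
    ring_nf
  simp_rw [h3]
  rw [lintegral_const_mul' _ _ ENNReal.ofReal_ne_top]
  calc _ ≤ ENNReal.ofReal (Real.exp (-(l ^ 2 / 2))) *
        (ENNReal.ofReal (Real.exp (l ^ 2 / 2)) * P B) := mul_le_mul_right h1 _
    _ = P B := by
      rw [← mul_assoc, ← ENNReal.ofReal_mul (Real.exp_pos _).le, ← Real.exp_add]
      simp

/-- Split `B` along the fibres of `Z`; each fibre is in the conditioning σ-algebra and `Z` is
constant on it. -/
theorem setLIntegral_exp_finite_range_le [IsProbabilityMeasure P]
    (hm : m ≤ mΩ) {η : Ω → ℝ} (hint : ∀ l : ℝ, Integrable (fun ω => Real.exp (l * η ω)) P)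
    (hsub : ∀ l : ℝ, P[fun ω => Real.exp (l * η ω) | m] ≤ᵐ[P] fun _ => Real.exp (l ^ 2 / 2))
    {Z : Ω → ℝ} {R : Finset ℝ} (hR : ∀ ω, Z ω ∈ R) (hZ : ∀ l, MeasurableSet[m] (Z ⁻¹' {l})) {B : Set Ω} (hB : MeasurableSet[m] B) :
    ∫⁻ ω in B, ENNReal.ofReal (Real.exp (Z ω * η ω - Z ω ^ 2 / 2)) ∂P ≤ P B := by
  have hU : B = ⋃ l ∈ R, B ∩ Z ⁻¹' {l} := by
    ext ω
    simp [hR]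
  have hd : (R : Set ℝ).PairwiseDisjoint fun l => B ∩ Z ⁻¹' {l} := by
    intro l _ l' _ hll'
    refine Set.disjoint_left.mpr fun ω h1 h2 => hll' ?_
    exact h1.2.symm.trans h2.2
  have hmeas : ∀ l, MeasurableSet[m] (B ∩ Z ⁻¹' {l}) := fun l =>
    hB.inter (hZ l)
  conv_lhs => rw [hU]
  conv_rhs => rw [hU]
  rw [lintegral_biUnion_finset hd fun l _ => hm _ (hmeas l),
    measure_biUnion_finset hd fun l _ => hm _ (hmeas l)]
  refine Finset.sum_le_sum fun l _ => ?_
  refine le_trans (le_of_eq ?_) (setLIntegral_exp_le hm hint hsub l (hmeas l))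
  refine setLIntegral_congr_fun (hm _ (hmeas l)) fun ω hω => ?_
  have : Z ω = l := hω.2
  simp only [this]

/-- Approximate `Z` pointwise by simple functions of the same σ-algebra and apply Fatou's lemma,
which needs no bound on `Z`. -/
theorem setLIntegral_exp_measurable_le [IsProbabilityMeasure P]
    (hm : m ≤ mΩ) {η : Ω → ℝ} (hη : Measurable η)
    (hint : ∀ l : ℝ, Integrable (fun ω => Real.exp (l * η ω)) P)
    (hsub : ∀ l : ℝ, P[fun ω => Real.exp (l * η ω) | m] ≤ᵐ[P] fun _ => Real.exp (l ^ 2 / 2))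
    {Z : Ω → ℝ} (hZ : Measurable[m] Z) {B : Set Ω} (hB : MeasurableSet[m] B) :
    ∫⁻ ω in B, ENNReal.ofReal (Real.exp (Z ω * η ω - Z ω ^ 2 / 2)) ∂P ≤ P B := by
  have hZs : StronglyMeasurable[m] Z := hZ.stronglyMeasurable
  have hlim : ∀ ω, ENNReal.ofReal (Real.exp (Z ω * η ω - Z ω ^ 2 / 2)) =
      Filter.liminf (fun n => ENNReal.ofReal
        (Real.exp (hZs.approx n ω * η ω - hZs.approx n ω ^ 2 / 2))) Filter.atTop := fun ω => by
    refine (Filter.Tendsto.liminf_eq ?_).symm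
    have hc : Continuous fun z : ℝ => ENNReal.ofReal (Real.exp (z * η ω - z ^ 2 / 2)) := by
      exact ENNReal.continuous_ofReal.comp (by fun_prop)
    exact (hc.tendsto _).comp (hZs.tendsto_approx ω)
  simp_rw [hlim]
  refine (lintegral_liminf_le fun n => ?_).trans ?_
  · have : Measurable (hZs.approx n) := (@SimpleFunc.measurable Ω ℝ m _ (hZs.approx n)).mono hm le_rfl
    fun_prop
  · refine (Filter.liminf_le_liminf (Filter.Eventually.of_forall fun n =>
      setLIntegral_exp_finite_range_le hm hint hsub
        (R := @SimpleFunc.range Ω ℝ m (hZs.approx n))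
        (fun ω => @SimpleFunc.mem_range_self Ω ℝ m (hZs.approx n) ω)
        (@SimpleFunc.measurableSet_fiber Ω ℝ m (hZs.approx n)) hB)).trans ?_
    simp

theorem lintegral_mul_exp_le [IsProbabilityMeasure P]
    (hm : m ≤ mΩ) {η : Ω → ℝ} (hη : Measurable η)
    (hint : ∀ l : ℝ, Integrable (fun ω => Real.exp (l * η ω)) P)
    (hsub : ∀ l : ℝ, P[fun ω => Real.exp (l * η ω) | m] ≤ᵐ[P] fun _ => Real.exp (l ^ 2 / 2))
    {Z : Ω → ℝ} (hZ : Measurable[m] Z) {f : Ω → ENNReal} (hf : Measurable[m] f)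
    {B : Set Ω} (hB : MeasurableSet[m] B) :
    ∫⁻ ω in B, f ω * ENNReal.ofReal (Real.exp (Z ω * η ω - Z ω ^ 2 / 2)) ∂P ≤
      ∫⁻ ω in B, f ω ∂P := by
  set g : Ω → ENNReal := fun ω => ENNReal.ofReal (Real.exp (Z ω * η ω - Z ω ^ 2 / 2)) with hg
  have hZ' : Measurable Z := hZ.mono hm le_rfl
  have hf' : Measurable f := hf.mono hm le_rfl
  have hgm : Measurable g := by fun_prop
  -- The previous bound on sets says that the measure `g P` is dominated by `P` on `m`; integrating
  -- an `m`-measurable weight preserves this.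
  have hle : (P.withDensity g).trim hm ≤ P.trim hm := by
    refine Measure.le_iff.mpr fun C hC => ?_
    rw [trim_measurableSet_eq hm hC, trim_measurableSet_eq hm hC, withDensity_apply _ (hm _ hC)]
    exact setLIntegral_exp_measurable_le hm hη hint hsub hZ hC
  have hfB : Measurable[m] (B.indicator f) := hf.indicator hB
  rw [← lintegral_indicator (hm _ hB), ← lintegral_indicator (hm _ hB), ← lintegral_trim hm hfB]
  calc ∫⁻ ω, B.indicator (fun ω => f ω * g ω) ω ∂P
      = ∫⁻ ω, B.indicator f ω ∂(P.withDensity g) := by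
        rw [lintegral_withDensity_eq_lintegral_mul P hgm (hf'.indicator (hm _ hB))]
        refine lintegral_congr fun ω => ?_
        by_cases h : ω ∈ B <;> simp [h, mul_comm]
    _ = ∫⁻ ω, B.indicator f ω ∂((P.withDensity g).trim hm) := (lintegral_trim hm hfB).symm
    _ ≤ _ := lintegral_mono' hle le_rfl

end Subgaussian

/-! ### Self-normalised concentration by the method of mixtures. -/

section SelfNormalized

variable {Ω : Type*} {mΩ : MeasurableSpace Ω} {P : Measure Ω} {ℱ : Filtration ℕ mΩ}

/-- The integrand in the method of mixtures. -/
def mixtureDensity {α : Type*} {d : ℕ} (η : ℕ → α → ℝ) (A : ℕ → α → Vec d) (t : ℕ)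
    (p : α × Vec d) : ENNReal :=
  ENNReal.ofReal (Real.exp (⟪p.2, ∑ u ∈ Finset.range t, η u p.1 • A u p.1⟫_ℝ -
    1 / 2 * (‖p.2‖ ^ 2 + ∑ u ∈ Finset.range t, ⟪p.2, A u p.1⟫_ℝ ^ 2)))

theorem measurable_mixtureDensity {α : Type*} [MeasurableSpace α] {d : ℕ} {η : ℕ → α → ℝ}
    {A : ℕ → α → Vec d} {t : ℕ} (hη : ∀ u < t, Measurable (η u))
    (hA : ∀ u < t, Measurable (A u)) : Measurable (mixtureDensity η A t) := by
  have h1 : ∀ u ∈ Finset.range t, Measurable fun p : α × Vec d => A u p.1 := fun u hu =>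
    (hA u (Finset.mem_range.mp hu)).comp measurable_fst
  have h2 : ∀ u ∈ Finset.range t, Measurable fun p : α × Vec d => η u p.1 := fun u hu =>
    (hη u (Finset.mem_range.mp hu)).comp measurable_fst
  have h3 : Measurable fun p : α × Vec d => p.2 := measurable_snd
  refine ENNReal.measurable_ofReal.comp (Real.measurable_exp.comp (Measurable.sub ?_ ?_))
  · exact h3.inner (Finset.measurable_fun_sum _ fun u hu => (h2 u hu).smul (h1 u hu))
  · exact ((h3.norm.pow_const 2).add (Finset.measurable_fun_sum _ fun u hu =>
      (h3.inner (h1 u hu)).pow_const 2)).const_mul _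

/-- The design matrix of `d`-dimensional actions as a quadratic form. -/
theorem dotProduct_design_mulVec {d : ℕ} (A : ℕ → Vec d) (U : Finset ℕ) (x : Vec d) :
    x.ofLp ⬝ᵥ (design 1 A U *ᵥ x.ofLp) = ‖x‖ ^ 2 + ∑ u ∈ U, ⟪x, A u⟫_ℝ ^ 2 := by
  rw [design, one_smul, Matrix.add_mulVec, Matrix.one_mulVec, dotProduct_add,
    norm_sq_eq_dotProduct, Matrix.sum_mulVec, dotProduct_sum]
  congr 1
  refine Finset.sum_congr rfl fun u _ => ?_
  rw [outer_mulVec, dotProduct_smul, smul_eq_mul, inner_eq_dotProduct, dotProduct_comm, sq]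

/-- Self-normalised concentration: simultaneously for all `t ≤ n`, the martingale `∑ η_u A_u` is
controlled in the norm of the inverse design matrix. -/
theorem measure_selfNormalized_le [IsProbabilityMeasure P] {d : ℕ} {η : ℕ → Ω → ℝ}
    (hη : ∀ t, Measurable[ℱ (t + 1)] (η t))
    (hint : ∀ t (l : ℝ), Integrable (fun ω => Real.exp (l * η t ω)) P)
    (hsub : ∀ t (l : ℝ),
      P[fun ω => Real.exp (l * η t ω) | ℱ t] ≤ᵐ[P] fun _ => Real.exp (l ^ 2 / 2))
    {A : ℕ → Ω → Vec d} (hA : ∀ t, Measurable[ℱ t] (A t)) {δ : ℝ} (hδ : 0 < δ) (n : ℕ) :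
    P {ω | ∃ t ≤ n, 2 * Real.log (1 / δ) +
        Real.log (design 1 (fun u => A u ω) (Finset.range t)).det ≤
      weightedNorm (design 1 (fun u => A u ω) (Finset.range t))⁻¹
        (∑ u ∈ Finset.range t, η u ω • A u ω) ^ 2} ≤ ENNReal.ofReal δ := by
  set m : ℕ → Ω × Vec d → ENNReal := mixtureDensity η A with hm
  have hmm : ∀ t, Measurable[(ℱ t).prod inferInstance] (m t) := fun t =>
    @measurable_mixtureDensity Ω (ℱ t) d η A t
      (fun u hu => (hη u).mono (ℱ.mono hu) le_rfl) (fun u hu => (hA u).mono (ℱ.mono hu.le) le_rfl)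
  have hmm' : ∀ t, Measurable (m t) := fun t =>
    measurable_mixtureDensity (fun u _ => (hη u).mono (ℱ.le _) le_rfl)
      (fun u _ => (hA u).mono (ℱ.le _) le_rfl)
  -- The exponential supermartingales in the directions `x` are averaged against an unnormalised
  -- Gaussian weight, which contributes the identity in the design matrix.
  set M : ℕ → Ω → ENNReal := fun t ω => ∫⁻ x : Vec d, m t (ω, x) with hM
  have hMm : ∀ t, Measurable[ℱ t] (M t) := fun t =>
    @Measurable.lintegral_prod_right' _ _ (ℱ t) _ _ _ _ (hmm t)
  have hMeq : ∀ t ω, M t ω = ENNReal.ofReal (Real.exp (1 / 2 *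
      weightedNorm (design 1 (fun u => A u ω) (Finset.range t))⁻¹
        (∑ u ∈ Finset.range t, η u ω • A u ω) ^ 2 -
      1 / 2 * Real.log (design 1 (fun u => A u ω) (Finset.range t)).det)) * gaussConst d := by
    intro t ω
    rw [← lintegral_gaussian (design_posDef _ _)]
    simp_rw [dotProduct_design_mulVec]
    rfl
  have hstep : ∀ t ω x, m (t + 1) (ω, x) = m t (ω, x) *
      ENNReal.ofReal (Real.exp (⟪x, A t ω⟫_ℝ * η t ω - ⟪x, A t ω⟫_ℝ ^ 2 / 2)) := by
    intro t ω x
    simp only [hm, mixtureDensity]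
    rw [← ENNReal.ofReal_mul (Real.exp_pos _).le, ← Real.exp_add, Finset.sum_range_succ,
      Finset.sum_range_succ, inner_add_right, inner_smul_right]
    congr 2
    ring
  have hηm : ∀ t, Measurable (η t) := fun t => (hη t).mono (ℱ.le _) le_rfl
  have hsup : ∀ t B, MeasurableSet[ℱ t] B →
      ∫⁻ ω in B, M (t + 1) ω ∂P ≤ ∫⁻ ω in B, M t ω ∂P := by
    intro t B hB
    simp only [hM]
    rw [lintegral_lintegral_swap (f := fun ω x => m (t + 1) (ω, x)) (hmm' (t + 1)).aemeasurable,
      lintegral_lintegral_swap (f := fun ω x => m t (ω, x)) (hmm' t).aemeasurable]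
    refine lintegral_mono fun x => ?_
    simp_rw [hstep]
    exact lintegral_mul_exp_le (ℱ.le t) (hηm t) (hint t) (hsub t)
      (measurable_const.inner (hA t))
      ((hmm t).comp (@measurable_prodMk_right _ _ (ℱ t) _ x)) hB
  -- The level is `1 / δ` times the initial value `gaussConst d`; this constant is nonzero and
  -- finite, so it cancels.
  have hville := mul_measure_exists_le hMm hsup (ENNReal.ofReal (1 / δ) * gaussConst d) n
  have hM0 : ∫⁻ ω, M 0 ω ∂P = gaussConst d := by
    have : ∀ ω, M 0 ω = gaussConst d := fun ω => by
      simp only [hM, hm, mixtureDensity, gaussConst]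
      refine lintegral_congr fun x => ?_
      simp
    simp_rw [this]
    simp
  rw [hM0] at hville
  have hsubset : {ω | ∃ t ≤ n, 2 * Real.log (1 / δ) +
        Real.log (design 1 (fun u => A u ω) (Finset.range t)).det ≤
      weightedNorm (design 1 (fun u => A u ω) (Finset.range t))⁻¹
        (∑ u ∈ Finset.range t, η u ω • A u ω) ^ 2} ⊆
      {ω | ∃ t ≤ n, ENNReal.ofReal (1 / δ) * gaussConst d ≤ M t ω} := by
    rintro ω ⟨t, ht, h⟩
    refine ⟨t, ht, ?_⟩
    rw [hMeq]
    refine mul_le_mul_left (ENNReal.ofReal_le_ofReal ?_) _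
    rw [← Real.log_le_iff_le_exp (by positivity)]
    linarith
  refine (measure_mono hsubset).trans ?_
  rw [mul_right_comm, mul_comm _ (gaussConst d)] at hville
  replace hville := hville.trans_eq (mul_one (gaussConst d)).symm
  rw [ENNReal.mul_le_mul_iff_right gaussConst_ne_zero gaussConst_ne_top] at hville
  calc _ = ENNReal.ofReal δ * (ENNReal.ofReal (1 / δ) *
        P {ω | ∃ t ≤ n, ENNReal.ofReal (1 / δ) * gaussConst d ≤ M t ω}) := by
        rw [← mul_assoc, ← ENNReal.ofReal_mul hδ.le, mul_one_div_cancel hδ.ne',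
          ENNReal.ofReal_one, one_mul]
    _ ≤ ENNReal.ofReal δ * 1 := mul_le_mul_right hville _
    _ = _ := mul_one _

end SelfNormalized

/-! ### Estimation error of the CORE-SET phase. -/

section CorePhase

theorem sum_range_mul_eq {M : Type*} [AddCommMonoid M] (f : ℕ → M) (n m : ℕ) :
    ∑ u ∈ Finset.range (n * m), f u = ∑ k ∈ Finset.range n, ∑ r ∈ Finset.range m, f (k * m + r) := by
  induction n with
  | zero => simp
  | succ n ih => rw [Nat.succ_mul, Finset.sum_range_add, ih, Finset.sum_range_succ]

theorem sum_range_passes {M : Type*} [AddCommMonoid M] (f : ℕ → M) (n d L : ℕ) :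
    ∑ u ∈ Finset.range (n * (d * L)), f u =
      ∑ k ∈ Finset.range n, ∑ i : Fin d, ∑ q : Fin L, f (k * (d * L) + i * L + q) := by
  rw [sum_range_mul_eq]
  refine Finset.sum_congr rfl fun k _ => ?_
  rw [sum_range_mul_eq, Finset.sum_range]
  refine Finset.sum_congr rfl fun i _ => ?_
  rw [Finset.sum_range]
  simp only [add_assoc]

variable {d L : ℕ}

/-- The action of CORE-SET in round `u`, if the vector `p` is queried in this round, else `0`. -/
def coreAction (d : ℕ) {L : ℕ} (p : Fin L) (u : ℕ) : Vec d :=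
  if u % L = p then WithLp.toLp 2 fun i => if u / L % d = i then 1 else 0 else 0

theorem coreAction_apply (p q : Fin L) (k : ℕ) (i : Fin d) :
    coreAction d p (k * (d * L) + i * L + q) = if q = p then EuclideanSpace.single i 1 else 0 := by
  have hL : 0 < L := p.pos
  have h1 : (k * (d * L) + i * L + q) % L = q := by
    rw [show k * (d * L) + i * L + q = q + (k * d + i) * L by ring, Nat.add_mul_mod_self_right,
      Nat.mod_eq_of_lt q.2]
  have h2 : (k * (d * L) + i * L + q) / L % d = i := by
    rw [show k * (d * L) + i * L + q = q + (k * d + i) * L by ring,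
      Nat.add_mul_div_right _ _ hL, Nat.div_eq_of_lt q.2, zero_add, add_comm,
      Nat.add_mul_mod_self_right, Nat.mod_eq_of_lt i.2]
  rw [coreAction, h1, h2]
  simp only [Fin.val_inj]
  split_ifs
  · ext j
    simp [eq_comm]
  · rfl

/-- The accumulated noise of the queries of the vector `p` in `n` passes of CORE-SET. -/
def coreNoise (d : ℕ) {L : ℕ} (η : ℕ → ℝ) (n : ℕ) (p : Fin L) : Vec d :=
  ∑ k ∈ Finset.range n, ∑ i : Fin d, η (k * (d * L) + i * L + p) • EuclideanSpace.single i 1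

theorem sum_smul_coreAction (η : ℕ → ℝ) (n : ℕ) (p : Fin L) :
    ∑ u ∈ Finset.range (n * (d * L)), η u • coreAction d p u = coreNoise d η n p := by
  rw [sum_range_passes, coreNoise]
  refine Finset.sum_congr rfl fun k _ => Finset.sum_congr rfl fun i _ => ?_
  simp only [coreAction_apply, smul_ite, smul_zero, Finset.sum_ite_eq', Finset.mem_univ, if_true]

theorem outer_zero : outer (0 : Vec d) = 0 := by
  simp [outer]

theorem sum_outer_single : ∑ i : Fin d, outer (EuclideanSpace.single i (1 : ℝ)) = 1 := by
  ext a b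
  rw [Matrix.sum_apply]
  simp [outer, Matrix.vecMulVec_apply, Pi.single_apply, Matrix.one_apply]

theorem design_coreAction (n : ℕ) (p : Fin L) :
    design 1 (coreAction d p) (Finset.range (n * (d * L))) =
      ((1 : ℝ) + n) • (1 : Matrix (Fin d) (Fin d) ℝ) := by
  rw [design, sum_range_passes, add_smul]
  congr 1
  simp only [coreAction_apply, apply_ite outer, outer_zero, Finset.sum_ite_eq', Finset.mem_univ,
    if_true, sum_outer_single, Finset.sum_const, Finset.card_range, Nat.cast_smul_eq_nsmul]

theorem smul_one_inv {c : ℝ} (hc : c ≠ 0) :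
    (c • (1 : Matrix (Fin d) (Fin d) ℝ))⁻¹ = c⁻¹ • 1 := by
  refine Matrix.inv_eq_right_inv ?_
  rw [Matrix.smul_mul, Matrix.mul_smul, one_mul, smul_smul, mul_inv_cancel₀ hc, one_smul]

/-- The self-normalised bound for the noise of CORE-SET, made explicit. -/
theorem norm_coreNoise_sq_le {η : ℕ → ℝ} {n : ℕ} {p : Fin L} {l : ℝ}
    (h : weightedNorm (design 1 (coreAction d p) (Finset.range (n * (d * L))))⁻¹
        (∑ u ∈ Finset.range (n * (d * L)), η u • coreAction d p u) ^ 2 ≤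
      2 * l + Real.log (design 1 (coreAction d p) (Finset.range (n * (d * L)))).det) :
    ‖coreNoise d η n p‖ ^ 2 ≤ (n + 1) * (2 * l + d * Real.log (n + 1)) := by
  have hn : (0 : ℝ) < 1 + n := by positivity
  rw [weightedNorm_sq (design_posDef _ _).inv.posSemidef, sum_smul_coreAction, design_coreAction,
    smul_one_inv hn.ne', Matrix.smul_mulVec, Matrix.one_mulVec, dotProduct_smul,
    ← norm_sq_eq_dotProduct, Matrix.det_smul, Matrix.det_one, mul_one, Fintype.card_fin,
    Real.log_pow, smul_eq_mul, inv_mul_le_iff₀ hn, add_comm (1 : ℝ)] at h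
  exact h

/-- The estimates of CORE-SET in terms of the noise alone. -/
def coreApprox (ρ₀ : ℝ) (θ : Fin (L + 1) → Vec d) (η : ℕ → ℝ) (n : ℕ) (p : Fin L) : Vec d :=
  (ρ₀ + n)⁻¹ • ((n : ℝ) • θ p.succ + coreNoise d η n p)

theorem coreEstimate_eq_coreApprox {ρ₀ : ℝ} (hρ₀ : ρ₀ = 0 ∨ ρ₀ = 1) {θ : Fin (L + 1) → Vec d}
    {A : ℕ → Vec d} {I : ℕ → Fin (L + 1)} {η X : ℕ → ℝ}
    (hX : ∀ t, X t = ⟪A t, θ (I t)⟫_ℝ + η t) {n : ℕ}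
    (hplay : ∀ k < n, ∀ (i : Fin d) (p : Fin L),
      A (k * (d * L) + i * L + p) = EuclideanSpace.single i 1 ∧
      I (k * (d * L) + i * L + p) = p.succ) (p : Fin L) :
    coreEstimate ρ₀ A I X n p = coreApprox ρ₀ θ η n p := by
  have hsum : ∀ {M : Type} [AddCommMonoid M] (f : ℕ → M),
      ∑ u ∈ queried I p.succ 0 (n * (d * L)), f u =
        ∑ k ∈ Finset.range n, ∑ i : Fin d, f (k * (d * L) + i * L + p) := by
    intro M _ f
    rw [queried, Nat.Ico_zero_eq_range, Finset.sum_filter, sum_range_passes]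
    refine Finset.sum_congr rfl fun k hk => Finset.sum_congr rfl fun i _ => ?_
    simp only [(hplay k (Finset.mem_range.mp hk) i _).2, Fin.succ_inj, Finset.sum_ite_eq',
      Finset.mem_univ, if_true]
  have hdes : design ρ₀ A (queried I p.succ 0 (n * (d * L))) =
      (ρ₀ + n) • (1 : Matrix (Fin d) (Fin d) ℝ) := by
    rw [design, hsum, add_smul]
    congr 1
    rw [Finset.sum_congr rfl fun k hk => Finset.sum_congr rfl fun i _ => by
      rw [(hplay k (Finset.mem_range.mp hk) i p).1]]
    simp only [sum_outer_single, Finset.sum_const, Finset.card_range, Nat.cast_smul_eq_nsmul]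
  have hvec : (∑ u ∈ queried I p.succ 0 (n * (d * L)), X u • (A u).ofLp) =
      ((n : ℝ) • θ p.succ + coreNoise d η n p).ofLp := by
    rw [hsum, coreNoise, WithLp.ofLp_add, WithLp.ofLp_sum]
    have h1 : ((n : ℝ) • θ p.succ).ofLp = ∑ k ∈ Finset.range n, (θ p.succ).ofLp := by
      rw [Finset.sum_const, Finset.card_range, WithLp.ofLp_smul, Nat.cast_smul_eq_nsmul]
    rw [h1, ← Finset.sum_add_distrib]
    refine Finset.sum_congr rfl fun k hk => ?_
    have h2 : (θ p.succ).ofLp =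
        ∑ i : Fin d, (θ p.succ i) • (EuclideanSpace.single i (1 : ℝ)).ofLp := by
      ext j
      simp [Pi.single_apply]
    rw [WithLp.ofLp_sum, h2, ← Finset.sum_add_distrib]
    refine Finset.sum_congr rfl fun i _ => ?_
    obtain ⟨h3, h4⟩ := hplay k (Finset.mem_range.mp hk) i p
    rw [hX, h3, h4, EuclideanSpace.inner_single_left, WithLp.ofLp_smul, ← add_smul]
    simp
  rw [coreEstimate, estimate, hdes, hvec, coreApprox]
  -- Without regularisation and before the first pass, the design matrix is zero; the conventions
  -- for inverses make both sides zero.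
  by_cases hc : ρ₀ + n = 0
  · have hn : n = 0 := by
      have : (0 : ℝ) ≤ n := Nat.cast_nonneg n
      rcases hρ₀ with h | h <;> rw [h] at hc
      · exact_mod_cast (zero_add (n : ℝ)).symm.trans hc
      · linarith
    subst hn
    simp [coreNoise]
  · rw [smul_one_inv hc, Matrix.smul_mulVec, Matrix.one_mulVec]
    rfl

theorem norm_coreApprox_sub_sq_le {ρ₀ : ℝ} (hρ₀ : ρ₀ = 0 ∨ ρ₀ = 1) {θ : Fin (L + 1) → Vec d}
    (hθ : ∀ j, ‖θ j‖ ≤ 1) {η : ℕ → ℝ} {n : ℕ} (hn : 1 ≤ n) {p : Fin L} {l : ℝ}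
    (h : ‖coreNoise d η n p‖ ^ 2 ≤ (n + 1) * (2 * l + d * Real.log (n + 1))) :
    ‖coreApprox ρ₀ θ η n p - θ p.succ‖ ^ 2 ≤
      (4 * (d * Real.log (n + 1)) + 8 * l + 2) / (n + 1) := by
  have hn' : (1 : ℝ) ≤ n := by exact_mod_cast hn
  set B : ℝ := 2 * l + d * Real.log (n + 1) with hB
  have hB0 : 0 ≤ B := by
    have : 0 ≤ (n + 1 : ℝ) * B := (by positivity : (0 : ℝ) ≤ _).trans h
    exact nonneg_of_mul_nonneg_right this (by positivity)
  have hgoal : 4 * (d * Real.log (n + 1)) + 8 * l + 2 = 4 * B + 2 := by rw [hB]; ring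
  rw [hgoal]
  have hm : (0 : ℝ) < n + 1 := by positivity
  rcases hρ₀ with rfl | rfl
  · have : coreApprox 0 θ η n p - θ p.succ = (n : ℝ)⁻¹ • coreNoise d η n p := by
      rw [coreApprox, zero_add, smul_add, smul_smul, inv_mul_cancel₀ (by positivity), one_smul,
        add_sub_cancel_left]
    rw [this, norm_smul, norm_inv, Real.norm_natCast, mul_pow, inv_pow,
      inv_mul_le_iff₀ (by positivity)]
    refine h.trans ?_
    rw [← mul_div_assoc, le_div_iff₀ hm]
    -- Dividing by `n` instead of `n + 1` costs a factor 4, from `(n + 1)² ≤ 4 n²` for `n ≥ 1`.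
    nlinarith [mul_nonneg hB0 (by nlinarith : (0 : ℝ) ≤ 4 * (n : ℝ) ^ 2 - (n + 1) ^ 2)]
  · have : coreApprox 1 θ η n p - θ p.succ =
        ((1 : ℝ) + n)⁻¹ • (coreNoise d η n p - θ p.succ) := by
      have h1 : θ p.succ = ((1 : ℝ) + n)⁻¹ • ((1 + n : ℝ) • θ p.succ) := by
        rw [smul_smul, inv_mul_cancel₀ (by positivity), one_smul]
      rw [coreApprox]
      nth_rewrite 2 [h1]
      rw [← smul_sub]
      congr 1
      module
    have h2 : ‖coreNoise d η n p - θ p.succ‖ ^ 2 ≤ 2 * ‖coreNoise d η n p‖ ^ 2 + 2 := by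
      have h3 := norm_sub_le (coreNoise d η n p) (θ p.succ)
      have h4 := hθ p.succ
      have h5 := norm_nonneg (coreNoise d η n p - θ p.succ)
      nlinarith [sq_nonneg (‖coreNoise d η n p‖ - 1), norm_nonneg (coreNoise d η n p)]
    rw [this, norm_smul, mul_pow, Real.norm_of_nonneg (by positivity), inv_pow,
      inv_mul_le_iff₀ (by positivity)]
    refine h2.trans ?_
    rw [← mul_div_assoc, le_div_iff₀ hm]
    nlinarith [mul_nonneg hB0 hm.le, mul_pos hm hm]

theorem threeHalves_le_log_six : 3 / 2 ≤ Real.log 6 := by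
  have h1 : Real.exp 1 < 2.7182818286 := Real.exp_one_lt_d9
  have h2 : Real.exp (3 / 2) ^ 2 = Real.exp 1 ^ 3 := by
    rw [← Real.exp_nat_mul, ← Real.exp_nat_mul]; norm_num
  have h3 : Real.exp 1 ^ 3 ≤ 2.7182818286 ^ 3 :=
    pow_le_pow_left₀ (Real.exp_pos 1).le h1.le 3
  rw [Real.le_log_iff_exp_le (by norm_num)]
  refine (sq_le_sq₀ (Real.exp_pos _).le (by norm_num)).mp ?_
  rw [h2]
  refine h3.trans (by norm_num)

/-- With `log m ≤ 2 (√m - 1)` and `log 6 ≥ 3/2`. Multiplied by `L`, the right side is a quarter of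
the CORE-SET threshold. -/
theorem coreError_le {D l m : ℝ} (hD : 1 ≤ D) (hl : 0 ≤ l) (hm : 1 ≤ m) :
    (4 * (D * Real.log m) + 8 * l + 2) / m ≤ 8 * (D * Real.log 6 + l) / √m := by
  have hs : 1 ≤ √m := Real.one_le_sqrt.mpr hm
  have hlog : Real.log m ≤ 2 * (√m - 1) := by
    have h := Real.log_le_sub_one_of_pos (by positivity : (0 : ℝ) < √m)
    rw [Real.log_sqrt (by positivity)] at h
    linarith
  have h6 := threeHalves_le_log_six
  have hmm : √m * √m = m := Real.mul_self_sqrt (by positivity)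
  rw [div_le_div_iff₀ (by positivity) (by positivity)]
  nth_rewrite 3 [← hmm]
  rw [← mul_assoc _ √m √m]
  refine mul_le_mul_of_nonneg_right ?_ (by positivity)
  have h1 : D * Real.log m ≤ D * (2 * (√m - 1)) := mul_le_mul_of_nonneg_left hlog (by positivity)
  have h2 : D * (3 / 2) * √m ≤ D * Real.log 6 * √m := by gcongr
  nlinarith [mul_nonneg hl (sub_nonneg.mpr hs), mul_nonneg (by linarith : (0:ℝ) ≤ D)
    (sub_nonneg.mpr hs)]

/-- For large `m` the estimate `log m ≤ 4 m^{1/4}` improves the constant 8 to `8/5`, which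
corresponds to one twentieth of the threshold. This precision is what yields the constant 48 in the
length of CORE-SET. -/
theorem coreError_le_of_large {D l m : ℝ} (hD : 1 ≤ D) (hl : 0 ≤ l)
    (hm : (48 * (D * Real.log 6 + l)) ^ 2 ≤ m) :
    (4 * (D * Real.log m) + 8 * l + 2) / m ≤ 8 / 5 * (D * Real.log 6 + l) / √m := by
  have h6 := threeHalves_le_log_six
  have hD6 : D * (3 / 2) ≤ D * Real.log 6 := by gcongr
  have hW : 3 / 2 ≤ D * Real.log 6 + l := by linarith
  have hm0 : 0 < m := lt_of_lt_of_le (by positivity) hm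
  have hs : 72 ≤ √m := by
    refine le_trans ?_ (Real.le_sqrt_of_sq_le hm)
    linarith
  set r := √(√m) with hr
  have hrr : r * r = √m := Real.mul_self_sqrt (by positivity)
  have hr0 : 0 ≤ r := Real.sqrt_nonneg _
  have hr8 : 8 ≤ r := by nlinarith
  have hlog : Real.log m ≤ 4 * r := by
    have h := Real.log_le_sub_one_of_pos (by positivity : (0 : ℝ) < r)
    rw [hr, Real.log_sqrt (by positivity), Real.log_sqrt (by positivity)] at h
    linarith
  have hmm : √m * √m = m := Real.mul_self_sqrt (by positivity)
  rw [div_le_div_iff₀ (by positivity) (by positivity)]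
  nth_rewrite 3 [← hmm]
  rw [← mul_assoc _ √m √m]
  refine mul_le_mul_of_nonneg_right ?_ (by positivity)
  have h1 : D * Real.log m ≤ D * (4 * r) := mul_le_mul_of_nonneg_left hlog (by positivity)
  have h2 : D * (3 / 2) * √m ≤ D * Real.log 6 * √m := by gcongr
  have h3 : 72 * l ≤ √m * l := by gcongr
  have h4 : D * (8 * r) ≤ D * (r * r) := by gcongr
  nlinarith [mul_le_mul hD hr8 (by norm_num) (by linarith : (0 : ℝ) ≤ D)]

end CorePhase

/-! ### Comparing estimated and true singular values. -/

section CoreSet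

variable {d : ℕ} {ι : Type*}

/-- Both sets incur an error of at most `√τ / 2`. As `√τ < √(lamMin v S)`, this gives `√τ < 2
√(lamMin w S)`, and therefore `√(lamMin w S') ≤ √(lamMin w S) + √τ ≤ 3 √(lamMin w S)`. -/
theorem sqrt_lamMin_le_three_mul {v w : ι → Vec d} {S S' : Finset ι} (hS : S.Nonempty)
    (hcard : S'.card = S.card) {e τ : ℝ} (he : ∀ i, ‖v i - w i‖ ≤ e) (hτ0 : 0 ≤ τ)
    (hτ : τ < lamMin v S) (heτ : S.card * e ^ 2 ≤ τ / 4) (hmax : lamMin v S' ≤ lamMin v S) :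
    0 < lamMin w S ∧ √(lamMin w S') ≤ 3 * √(lamMin w S) := by
  have hS' : S'.Nonempty := Finset.card_pos.mp (hcard ▸ hS.card_pos)
  have h1 := sqrt_lamMin_le_add hS fun i _ => he i
  have h2 := sqrt_lamMin_le_add (v := w) (w := v) (e := e) hS' fun i _ => by
    rw [norm_sub_rev]; exact he i
  rw [hcard] at h2
  have he0 : 0 ≤ e := (norm_nonneg _).trans (he hS.choose)
  have h3 : √S.card * e ≤ √τ / 2 := by
    rw [← Real.sqrt_sq he0, ← Real.sqrt_mul (Nat.cast_nonneg _)]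
    refine Real.sqrt_le_iff.mpr ⟨by positivity, heτ.trans_eq ?_⟩
    rw [div_pow, Real.sq_sqrt hτ0]
    norm_num
  have h4 : √τ < √(lamMin v S) := Real.sqrt_lt_sqrt hτ0 hτ
  have h5 : √(lamMin v S') ≤ √(lamMin v S) := Real.sqrt_le_sqrt hmax
  have h6 : 0 < √(lamMin w S) := by
    have := Real.sqrt_nonneg τ
    linarith
  exact ⟨Real.sqrt_pos.mp h6, by linarith⟩

theorem lamMin_le_of_perturbation {v w : ι → Vec d} {S : Finset ι} (hS : S.Nonempty) {e τ : ℝ}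
    (he : ∀ i, ‖v i - w i‖ ≤ e) (hτ : lamMin v S ≤ τ) (heτ : S.card * e ^ 2 ≤ τ / 20) :
    lamMin w S ≤ 3 / 2 * τ := by
  have h2 := sqrt_lamMin_le_add (v := w) (w := v) (e := e) hS fun i _ => by
    rw [norm_sub_rev]; exact he i
  have hc : (√S.card * e) ^ 2 ≤ τ / 20 := by
    rw [mul_pow, Real.sq_sqrt (Nat.cast_nonneg _)]
    exact heτ
  have hb : √(lamMin v S) ^ 2 ≤ τ := by rwa [Real.sq_sqrt (lamMin_nonneg hS)]
  have ha : √(lamMin w S) ^ 2 = lamMin w S := Real.sq_sqrt (lamMin_nonneg hS)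
  have h3 : √(lamMin w S) ^ 2 ≤ (√(lamMin v S) + √S.card * e) ^ 2 :=
    pow_le_pow_left₀ (Real.sqrt_nonneg _) h2 2
  -- The weighted inequality `2ab ≤ (2/9) a² + (9/2) b²` gives `(a + b)² ≤ (11/9 + 11/40) τ ≤ (3/2)
  -- τ`.
  nlinarith [sq_nonneg (2 * √(lamMin v S) - 9 * (√S.card * e))]

end CoreSet

/-! ### Confidence ellipsoids. -/

section Confidence

variable {d : ℕ}

theorem estimate_sub {A : ℕ → Vec d} {η X : ℕ → ℝ} {U : Finset ℕ} {ϑ : Vec d}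
    (hX : ∀ u ∈ U, X u = ⟪A u, ϑ⟫_ℝ + η u) :
    estimate 1 A X U - ϑ =
      WithLp.toLp 2 ((design 1 A U)⁻¹ *ᵥ (∑ u ∈ U, η u • A u - ϑ).ofLp) := by
  have hV := design_posDef A U
  have h1 : ∑ u ∈ U, X u • (A u).ofLp =
      design 1 A U *ᵥ ϑ.ofLp + (∑ u ∈ U, η u • A u - ϑ).ofLp := by
    rw [design, one_smul, Matrix.add_mulVec, Matrix.one_mulVec, Matrix.sum_mulVec,
      WithLp.ofLp_sub, WithLp.ofLp_sum,
      show ∀ a b c : Fin d → ℝ, a + b + (c - a) = b + c from fun a b c => by abel, ← Finset.sum_add_distrib]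
    refine Finset.sum_congr rfl fun u hu => ?_
    rw [hX u hu, outer_mulVec, ← inner_eq_dotProduct, add_smul]
    rfl
  rw [estimate, h1, Matrix.mulVec_add, Matrix.mulVec_mulVec,
    Matrix.nonsing_inv_mul _ (isUnit_iff_ne_zero.mpr hV.det_pos.ne'), Matrix.one_mulVec]
  ext i
  simp

/-- The estimation error is `V⁻¹ (∑ η_u A_u - ϑ)`: the noise gives the square root in the radius,
the regularisation bias gives the summand 1. The dimension is at least 2 so that `2 log (1/δ)` is
absorbed in `d log (1/δ)`. -/
theorem mem_confSet (hd : 2 ≤ d) {δ : ℝ} (hδ₀ : 0 < δ) (hδ₁ : δ ≤ 1) {A : ℕ → Vec d}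
    {η X : ℕ → ℝ} {U : Finset ℕ} {ϑ : Vec d} (hϑ : ‖ϑ‖ ≤ 1)
    (hX : ∀ u ∈ U, X u = ⟪A u, ϑ⟫_ℝ + η u) (hA : ∀ u ∈ U, ‖A u‖ ≤ 1)
    (h : weightedNorm (design 1 A U)⁻¹ (∑ u ∈ U, η u • A u) ^ 2 ≤
      2 * Real.log (1 / δ) + Real.log (design 1 A U).det) :
    ϑ ∈ confSet 1 1 1 δ A X U := by
  have hV := design_posDef A U
  have hd' : (2 : ℝ) ≤ d := by exact_mod_cast hd
  have hlogδ : 0 ≤ Real.log (1 / δ) := Real.log_nonneg (by rw [le_div_iff₀ hδ₀]; linarith)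
  have hlog : Real.log (design 1 A U).det ≤ d * Real.log (1 + U.card) := by
    refine (log_det_design_le (by omega) A U hA).trans ?_
    refine mul_le_mul_of_nonneg_left (Real.log_le_log (by positivity) ?_) (Nat.cast_nonneg _)
    exact add_le_add le_rfl (div_le_self (Nat.cast_nonneg _) (by linarith))
  change weightedNorm _ (_ - _) ≤ _
  rw [estimate_sub hX, weightedNorm_inv_mulVec hV, sqrtBeta]
  refine (weightedNorm_sub_le hV.inv _ _).trans (add_le_add ?_ ?_)
  · rw [one_mul]
    refine Real.le_sqrt_of_sq_le (h.trans ?_)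
    rw [div_eq_mul_one_div (1 + (U.card : ℝ) * 1 ^ 2 / 1) δ, one_pow, mul_one, div_one,
      Real.log_mul (by positivity) (by positivity), mul_add]
    nlinarith
  · rw [Real.sqrt_one, one_mul]
    exact (weightedNorm_inv_le_norm hV (design_sub_one_posSemidef A U) ϑ).trans hϑ

theorem sqrtBeta_mono {δ : ℝ} (hδ₀ : 0 < δ) {t t' : ℕ} (h : t ≤ t') :
    sqrtBeta d 1 1 1 δ t ≤ sqrtBeta d 1 1 1 δ t' := by
  have : (t : ℝ) ≤ t' := by exact_mod_cast h
  rw [sqrtBeta, sqrtBeta]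
  gcongr

theorem one_le_sqrtBeta (δ : ℝ) (t : ℕ) : 1 ≤ sqrtBeta d 1 1 1 δ t := by
  rw [sqrtBeta, one_mul, Real.sqrt_one, one_mul]
  linarith [Real.sqrt_nonneg (d * Real.log ((1 + t * 1 ^ 2 / 1) / δ))]

theorem abs_inner_sub_le {δ : ℝ} {A : ℕ → Vec d} {X : ℕ → ℝ} {U : Finset ℕ} {x y : Vec d}
    (hx : x ∈ confSet 1 1 1 δ A X U) (hy : y ∈ confSet 1 1 1 δ A X U) (a : Vec d) :
    |⟪a, x - y⟫_ℝ| ≤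
      2 * (weightedNorm (design 1 A U)⁻¹ a * sqrtBeta d 1 1 1 δ U.card) := by
  have hV := design_posDef A U
  have key : ∀ x y : Vec d, x ∈ confSet 1 1 1 δ A X U → y ∈ confSet 1 1 1 δ A X U →
      ⟪a, x - y⟫_ℝ ≤ 2 * (weightedNorm (design 1 A U)⁻¹ a * sqrtBeta d 1 1 1 δ U.card) := by
    intro x y hx hy
    have h1 := weightedNorm_sub_le hV (estimate 1 A X U - y) (estimate 1 A X U - x)
    rw [sub_sub_sub_cancel_left] at h1
    have h2 : weightedNorm (design 1 A U) (x - y) ≤ 2 * sqrtBeta d 1 1 1 δ U.card := by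
      have hx' : weightedNorm _ _ ≤ _ := hx
      have hy' : weightedNorm _ _ ≤ _ := hy
      linarith
    refine (inner_le_weightedNorm_mul hV a (x - y)).trans ?_
    refine (mul_le_mul_of_nonneg_left h2 (weightedNorm_nonneg _ _)).trans_eq ?_
    ring
  refine abs_le.mpr ⟨?_, key x y hx hy⟩
  have := key y x hy hx
  rw [← neg_sub x y, inner_neg_right] at this
  linarith

end Confidence

/-! ### Orthogonal projections and the regret of one optimistic round. -/

section Projection

variable {d : ℕ}

theorem inner_projPerp {W : Set (Vec d)} {a : Vec d} (ha : a ∈ (Submodule.span ℝ W)ᗮ) (x : Vec d) :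
    ⟪a, projPerp W x⟫_ℝ = ⟪a, x⟫_ℝ := by
  rw [projPerp, ← Submodule.inner_starProjection_left_eq_right,
    Submodule.starProjection_eq_self_iff.mpr ha]

theorem projPerp_mem (W : Set (Vec d)) (x : Vec d) : projPerp W x ∈ (Submodule.span ℝ W)ᗮ :=
  Submodule.starProjection_apply_mem _ _

theorem sub_projPerp_mem (W : Set (Vec d)) (x : Vec d) :
    x - projPerp W x ∈ Submodule.span ℝ W := by
  rw [projPerp, Submodule.starProjection_orthogonal_val, sub_sub_cancel]
  exact Submodule.starProjection_apply_mem _ _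

theorem norm_projPerp_le (W : Set (Vec d)) (x : Vec d) : ‖projPerp W x‖ ≤ ‖x‖ :=
  Submodule.norm_starProjection_apply_le _ _

theorem norm_sub_projPerp_le (W : Set (Vec d)) (x : Vec d) : ‖x - projPerp W x‖ ≤ ‖x‖ := by
  rw [projPerp, Submodule.starProjection_orthogonal_val, sub_sub_cancel]
  exact Submodule.norm_starProjection_apply_le _ _

theorem norm_le_inner_of_isMaxOn {q a : Vec d}
    (h : ∀ b ∈ Metric.closedBall (0 : Vec d) 1, ⟪b, q⟫_ℝ ≤ ⟪a, q⟫_ℝ) : ‖q‖ ≤ ⟪a, q⟫_ℝ := by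
  by_cases hq : q = 0
  · simp [hq]
  have hq' : ‖q‖ ≠ 0 := norm_ne_zero_iff.mpr hq
  have h1 := h (‖q‖⁻¹ • q) (by
    rw [mem_closedBall_zero_iff, norm_smul, norm_inv, norm_norm, inv_mul_cancel₀ hq'])
  rw [real_inner_smul_left, real_inner_self_eq_norm_sq, sq, inv_mul_cancel_left₀ hq'] at h1
  exact h1

theorem smul_eq_of_norm_le_inner {q a : Vec d} (ha : ‖a‖ ≤ 1) (h : ‖q‖ ≤ ⟪a, q⟫_ℝ) :
    q = ‖q‖ • a := by
  have h1 : ‖q - ‖q‖ • a‖ ^ 2 ≤ 0 := by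
    rw [norm_sub_sq_real, inner_smul_right, norm_smul, norm_norm, real_inner_comm]
    have h2 : ‖a‖ ^ 2 ≤ 1 := pow_le_one₀ (norm_nonneg _) ha
    nlinarith [norm_nonneg q, mul_nonneg (norm_nonneg q) (sub_nonneg.mpr h),
      mul_nonneg (sq_nonneg ‖q‖) (sub_nonneg.mpr h2)]
  have h2 : ‖q - ‖q‖ • a‖ = 0 := by nlinarith [norm_nonneg (q - ‖q‖ • a)]
  exact sub_eq_zero.mp (norm_eq_zero.mp h2)

/-- The maximising action is orthogonal to the optimistic protected vectors, so its inner products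
with the true ones are pure estimation errors. -/
theorem instant_regret_le {L : ℕ} {S : Finset (Fin L)} (hS : S.Nonempty)
    {θ ϑ : Fin (L + 1) → Vec d} (hθ : ‖θ 0‖ ≤ 1) {aStar a : Vec d} (ha : ‖a‖ ≤ 1) {w : ℝ}
    (hlam : 0 < lamMin (fun p : Fin L => θ p.succ) S)
    (haStar : ‖projPerp ((fun p : Fin L => θ p.succ) '' (S : Set (Fin L))) (θ 0)‖ ≤
      value S aStar θ)
    (hopt : value S aStar θ ≤ value S a ϑ)
    (hmax : ∀ b ∈ Metric.closedBall (0 : Vec d) 1, value S b ϑ ≤ value S a ϑ)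
    (hw : ∀ j ∈ coreIndices S, |⟪a, θ j - ϑ j⟫_ℝ| ≤ w) :
    value S aStar θ - value S a θ ≤
      (√S.card / √(lamMin (fun p : Fin L => θ p.succ) S) + 1) * w := by
  set σ := √(lamMin (fun p : Fin L => θ p.succ) S) with hσ
  have hσ0 : 0 < σ := Real.sqrt_pos.mpr hlam
  have h0 : (0 : Fin (L + 1)) ∈ coreIndices S := Finset.mem_insert_self _ _
  have hw0 : 0 ≤ w := (abs_nonneg _).trans (hw 0 h0)
  set W := (fun p : Fin L => θ p.succ) '' (S : Set (Fin L)) with hW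
  set W' := (fun p : Fin L => ϑ p.succ) '' (S : Set (Fin L)) with hW'
  set q := projPerp W' (ϑ 0) with hq
  have hval : value S a ϑ = ⟪a, q⟫_ℝ := rfl
  -- If the optimistic value vanishes, optimism forces the true residual to vanish as well, and
  -- every action has regret zero.
  by_cases hq0 : q = 0
  · rw [hval, hq0, inner_zero_right] at hopt
    have h1 : projPerp W (θ 0) = 0 := norm_le_zero_iff.mp (haStar.trans hopt)
    have h2 : value S aStar θ - value S a θ = 0 := by
      change ⟪aStar, projPerp W (θ 0)⟫_ℝ - ⟪a, projPerp W (θ 0)⟫_ℝ = 0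
      rw [h1, inner_zero_right, inner_zero_right, sub_zero]
    rw [h2]
    positivity
  · have h1 := smul_eq_of_norm_le_inner ha (norm_le_inner_of_isMaxOn (q := q) hmax)
    have ha' : a ∈ (Submodule.span ℝ W')ᗮ := by
      have h2 : a = ‖q‖⁻¹ • q := by
        rw [h1]
        nth_rewrite 1 [← h1]
        rw [smul_smul, inv_mul_cancel₀ (norm_ne_zero_iff.mpr hq0), one_smul]
      rw [h2]
      exact Submodule.smul_mem _ _ (projPerp_mem _ _)
    have hperp : ∀ i ∈ S, ⟪a, ϑ i.succ⟫_ℝ = 0 := fun i hi =>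
      (Submodule.mem_orthogonal' _ _).mp ha' _ (Submodule.subset_span ⟨i, hi, rfl⟩)
    have h2 : value S a ϑ = ⟪a, ϑ 0⟫_ℝ := inner_projPerp ha' _
    obtain ⟨c, hc⟩ := (Submodule.mem_span_image_finset_iff_exists_fun ℝ).mp
      (sub_projPerp_mem W (θ 0))
    set x : EuclideanSpace ℝ S := WithLp.toLp 2 c with hx
    have hc' : synth (fun p : Fin L => θ p.succ) S x = θ 0 - projPerp W (θ 0) := hc
    -- The coefficients of the projection of `θ 0` onto the protected span are controlled by the
    -- smallest singular value.
    have hnorm : ‖x‖ * σ ≤ 1 := by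
      have h3 := lamMin_mul_le (v := fun p : Fin L => θ p.succ) hS x
      rw [hc'] at h3
      have h4 : ‖θ 0 - projPerp W (θ 0)‖ ≤ 1 := (norm_sub_projPerp_le W _).trans hθ
      have h5 : (‖x‖ * σ) ^ 2 ≤ 1 ^ 2 := by
        rw [mul_pow, hσ, Real.sq_sqrt hlam.le, mul_comm]
        exact h3.trans (pow_le_pow_left₀ (norm_nonneg _) h4 2)
      exact (sq_le_sq₀ (by positivity) zero_le_one).mp h5
    have h3 : ⟪a, θ 0 - projPerp W (θ 0)⟫_ℝ ≤ √S.card / σ * w := by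
      rw [← hc', synth_apply, inner_sum]
      calc ∑ i : S, ⟪a, x i • θ (i : Fin L).succ⟫_ℝ
          = ∑ i : S, x i * ⟪a, θ (i : Fin L).succ - ϑ (i : Fin L).succ⟫_ℝ := by
            refine Finset.sum_congr rfl fun i _ => ?_
            rw [inner_smul_right, inner_sub_right, hperp i i.2, sub_zero]
        _ ≤ ∑ i : S, |x i| * w := by
            refine Finset.sum_le_sum fun i _ => (le_abs_self _).trans ?_
            rw [abs_mul]
            refine mul_le_mul_of_nonneg_left (hw _ ?_) (abs_nonneg _)
            exact Finset.mem_insert_of_mem (Finset.mem_map_of_mem _ i.2)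
        _ ≤ √S.card * ‖x‖ * w := by
            rw [← Finset.sum_mul]
            exact mul_le_mul_of_nonneg_right (sum_abs_le_sqrt_card_mul_norm x) hw0
        _ ≤ √S.card / σ * w := by
            refine mul_le_mul_of_nonneg_right ?_ hw0
            rw [div_eq_mul_inv]
            refine mul_le_mul_of_nonneg_left ?_ (Real.sqrt_nonneg _)
            rwa [← one_div, le_div_iff₀ hσ0]
    have h4 : ⟪a, ϑ 0 - θ 0⟫_ℝ ≤ w := by
      rw [← neg_sub, inner_neg_right]
      exact (neg_le_abs _).trans (hw 0 h0)
    have h5 : value S a θ = ⟪a, projPerp W (θ 0)⟫_ℝ := rfl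
    rw [inner_sub_right] at h3 h4
    rw [h2] at hopt
    rw [h5]
    linarith

end Projection

/-! ### The elliptical potential for several design matrices. -/

section Potential

variable {d L : ℕ}

theorem queried_succ (I : ℕ → Fin (L + 1)) (j : Fin (L + 1)) {lo t : ℕ} (h : lo ≤ t) :
    queried I j lo (t + 1) = if I t = j then insert t (queried I j lo t) else queried I j lo t := by
  rw [queried, ← Finset.insert_Ico_right_eq_Ico_add_one h, Finset.filter_insert]
  rfl

theorem card_queried_le (I : ℕ → Fin (L + 1)) (j : Fin (L + 1)) (lo t : ℕ) :
    (queried I j lo t).card ≤ t :=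
  (Finset.card_filter_le _ _).trans (by simp)

/-- Round `t` is a rank-one update of the matrix of the queried index only, so by the determinant
lemma the logarithms telescope separately for each index. -/
theorem sum_log_one_add_weightedNorm (A : ℕ → Vec d) (I : ℕ → Fin (L + 1)) {lo : ℕ}
    {J : Finset (Fin (L + 1))} {T : ℕ} (hT : lo ≤ T) (hI : ∀ t ∈ Finset.Ico lo T, I t ∈ J) :
    ∑ t ∈ Finset.Ico lo T,
        Real.log (1 + weightedNorm (design 1 A (queried I (I t) lo t))⁻¹ (A t) ^ 2) =
      ∑ j ∈ J, Real.log (design 1 A (queried I j lo T)).det := by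
  induction T, hT using Nat.le_induction with
  | base => simp [queried, design]
  | succ t ht ih =>
    have hmem : I t ∈ J := hI t (Finset.mem_Ico.mpr ⟨ht, t.lt_succ_self⟩)
    rw [Finset.sum_Ico_succ_top ht, ih fun u hu => hI u (by
      rw [Finset.mem_Ico] at hu ⊢; omega)]
    rw [← Finset.add_sum_erase _ _ hmem, ← Finset.add_sum_erase J
      (fun j => Real.log (design 1 A (queried I j lo (t + 1))).det) hmem]
    have h1 : ∀ j ∈ J.erase (I t), Real.log (design 1 A (queried I j lo (t + 1))).det =
        Real.log (design 1 A (queried I j lo t)).det := fun j hj => by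
      rw [queried_succ I j ht, if_neg (Finset.ne_of_mem_erase hj).symm]
    have hV := design_posDef A (queried I (I t) lo t)
    rw [Finset.sum_congr rfl h1, queried_succ I _ ht, if_pos rfl,
      design_insert A (by simp [queried]), det_add_outer hV,
      Real.log_mul hV.det_pos.ne' (by positivity)]
    ring

theorem min_one_le_mul_log {K x : ℝ} (hK : 0 ≤ K) (hx : 0 ≤ x) :
    min 1 (K * x) ≤ (K + 1) * Real.log (1 + x) := by
  have hlog : x / (1 + x) ≤ Real.log (1 + x) := by
    have h := Real.one_sub_inv_le_log_of_pos (by positivity : 0 < 1 + x)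
    refine le_trans (le_of_eq ?_) h
    field_simp
    ring
  refine le_trans ?_ (mul_le_mul_of_nonneg_left hlog (by positivity))
  rw [← mul_div_assoc, le_div_iff₀ (by positivity)]
  rcases le_total (K * x) 1 with h | h
  · rw [min_eq_right h]
    nlinarith
  · rw [min_eq_left h]
    nlinarith

theorem le_two_mul_log {x : ℝ} (hx : 0 ≤ x) (hx1 : x ≤ 1) : x ≤ 2 * Real.log (1 + x) := by
  have h := min_one_le_mul_log zero_le_one hx
  rw [one_mul, min_eq_right hx1] at h
  linarith

theorem sum_le_sqrt_card_mul_sum_sq {U : Finset ℕ} {y : ℕ → ℝ} {T : ℕ} {B : ℝ} (hT : U.card ≤ T)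
    (hB : ∑ t ∈ U, y t ^ 2 ≤ B) : ∑ t ∈ U, y t ≤ √(T * B) := by
  have hT' : (U.card : ℝ) ≤ T := by exact_mod_cast hT
  refine Real.le_sqrt_of_sq_le (sq_sum_le_card_mul_sum_sq.trans ?_)
  exact mul_le_mul hT' hB (Finset.sum_nonneg fun _ _ => sq_nonneg _) (Nat.cast_nonneg _)

/-- Cauchy-Schwarz in two ways: the first bound truncates the regret at 2 and uses `min 1 (K² x²) ≤
(K² + 1) log (1 + x²)`; the second uses `x² ≤ 2 log (1 + x²)` for `x ≤ 1`. -/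
theorem sum_le_of_sum_log_le {U : Finset ℕ} {r x : ℕ → ℝ} {T : ℕ} {K B : ℝ} (hK : 0 ≤ K)
    (hT : U.card ≤ T) (hr : ∀ t ∈ U, r t ≤ 2) (hrx : ∀ t ∈ U, r t ≤ 2 * (K * x t))
    (hx0 : ∀ t ∈ U, 0 ≤ x t) (hx1 : ∀ t ∈ U, x t ≤ 1)
    (hB : ∑ t ∈ U, Real.log (1 + x t ^ 2) ≤ B) :
    ∑ t ∈ U, r t ≤ 2 * √(T * ((K ^ 2 + 1) * B)) ∧ ∑ t ∈ U, r t ≤ 2 * K * √(T * (2 * B)) := by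
  constructor
  · calc ∑ t ∈ U, r t ≤ ∑ t ∈ U, 2 * min 1 (K * x t) := by
          refine Finset.sum_le_sum fun t ht => ?_
          rw [mul_min_of_nonneg _ _ zero_le_two, mul_one]
          exact le_min (hr t ht) (hrx t ht)
      _ ≤ _ := by
          rw [← Finset.mul_sum]
          refine mul_le_mul_of_nonneg_left (sum_le_sqrt_card_mul_sum_sq hT ?_) zero_le_two
          refine le_trans ?_ (mul_le_mul_of_nonneg_left hB (by positivity))
          rw [Finset.mul_sum]
          refine Finset.sum_le_sum fun t ht => ?_
          refine le_trans (le_of_eq ?_) (min_one_le_mul_log (sq_nonneg K) (sq_nonneg (x t)))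
          have h0 : 0 ≤ K * x t := mul_nonneg hK (hx0 t ht)
          rcases le_total (K * x t) 1 with h | h
          · rw [min_eq_right h, min_eq_right (by rw [← mul_pow]; exact pow_le_one₀ h0 h), mul_pow]
          · rw [min_eq_left h, min_eq_left (by rw [← mul_pow]; exact one_le_pow₀ h), one_pow]
  · calc ∑ t ∈ U, r t ≤ ∑ t ∈ U, 2 * K * x t := by
          refine Finset.sum_le_sum fun t ht => (hrx t ht).trans_eq (by ring)
      _ ≤ _ := by
          rw [← Finset.mul_sum]
          refine mul_le_mul_of_nonneg_left (sum_le_sqrt_card_mul_sum_sq hT ?_) (by positivity)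
          refine le_trans ?_ (mul_le_mul_of_nonneg_left hB zero_le_two)
          rw [Finset.mul_sum]
          exact Finset.sum_le_sum fun t ht => le_two_mul_log (sq_nonneg _)
            (pow_le_one₀ (hx0 t ht) (hx1 t ht))

end Potential

/-! ### Total regret of the optimistic phase. -/

section Optimistic

variable {d L : ℕ}

/-- A vector outside the span could be adjoined to `S`, producing a larger independent set. -/
theorem span_image_eq_of_maximal {v : Fin L → Vec d} {S : Finset (Fin L)}
    (hS : LinearIndependent ℝ fun i : S => v i)
    (hmax : ∀ S' : Finset (Fin L), S.card < S'.card → lamMin v S' = 0) :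
    Submodule.span ℝ (v '' (S : Set (Fin L))) = Submodule.span ℝ (Set.range v) := by
  refine le_antisymm (Submodule.span_mono (Set.image_subset_range _ _)) (Submodule.span_le.mpr ?_)
  rintro _ ⟨p, rfl⟩
  by_contra hp
  have hpS : p ∉ S := fun h => hp (Submodule.subset_span ⟨p, h, rfl⟩)
  have h0 := hmax (insert p S) (by rw [Finset.card_insert_of_notMem hpS]; omega)
  have h1 : LinearIndepOn ℝ v (insert p (S : Set (Fin L))) :=
    (linearIndepOn_insert (by simpa using hpS)).mpr ⟨hS, hp⟩
  rw [← Finset.coe_insert] at h1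
  exact ((lamMin_pos_iff (Finset.insert_nonempty p S)).mpr h1).ne' h0

theorem projPerp_eq_of_span_eq {W W' : Set (Vec d)}
    (h : Submodule.span ℝ W = Submodule.span ℝ W') : projPerp W = projPerp W' := by
  ext1 x
  simp only [projPerp, h]

theorem inner_sub_le_two {a b x : Vec d} (ha : ‖a‖ ≤ 1) (hb : ‖b‖ ≤ 1) (hx : ‖x‖ ≤ 1) :
    ⟪a - b, x⟫_ℝ ≤ 2 := by
  refine (real_inner_le_norm _ _).trans ?_
  have := norm_sub_le a b
  nlinarith [norm_nonneg x, norm_nonneg (a - b)]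

theorem norm_thetaPerp_le {θ : Fin (L + 1) → Vec d} (hθ : ‖θ 0‖ ≤ 1) : ‖thetaPerp θ‖ ≤ 1 :=
  (norm_projPerp_le _ _).trans hθ

theorem optimistic_regret_le (hd : 0 < d) (hL : 0 < L) {S : Finset (Fin L)} (hS : S.Nonempty)
    {θ : Fin (L + 1) → Vec d} (hθ : ∀ j, ‖θ j‖ ≤ 1) {δ : ℝ} (hδ : 0 < δ) {lo T : ℕ} (hT : lo ≤ T)
    {A : ℕ → Vec d} {I : ℕ → Fin (L + 1)} {X : ℕ → ℝ} {lam : ℝ} (hlam0 : 0 < lam) (hlam1 : lam ≤ 1)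
    (hlamS : 0 < lamMin (fun p : Fin L => θ p.succ) S)
    (hlam : √lam ≤ 3 * √(lamMin (fun p : Fin L => θ p.succ) S))
    (hperp : projPerp ((fun p : Fin L => θ p.succ) '' (S : Set (Fin L))) (θ 0) = thetaPerp θ)
    (hround : ∀ t, lo ≤ t → t < T → optimisticRound 1 1 1 δ A I X lo t S)
    (hconf : ∀ t, lo ≤ t → t < T → ∀ j ∈ coreIndices S,
      θ j ∈ confSet 1 1 1 δ A X (queried I j lo t))
    {aStar : Vec d} (haStar : aStar ∈ Metric.closedBall 0 1)
    (haStar' : IsMaxOn (fun a => ⟪a, thetaPerp θ⟫_ℝ) (Metric.closedBall 0 1) aStar) :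
    ∑ t ∈ Finset.Ico lo T, ⟪aStar - A t, thetaPerp θ⟫_ℝ ≤
        12 * √2 * ((S.card + 1) / lam) * √(T * d * Real.log (1 + T * L / d)) *
          sqrtBeta d 1 1 1 δ T ∧
      ∑ t ∈ Finset.Ico lo T, ⟪aStar - A t, thetaPerp θ⟫_ℝ ≤
        2 * √(((3 * √S.card / lam + 1) ^ 2 * sqrtBeta d 1 1 1 δ T ^ 2 + 1) *
              (S.card + 1) * T * d * Real.log (1 + T * L / d)) := by
  set b := sqrtBeta d 1 1 1 δ T with hb
  have hb0 : 0 ≤ b := zero_le_one.trans (one_le_sqrtBeta δ T)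
  set C := 3 * √S.card / lam + 1 with hC
  set Y := Real.log (1 + T * L / d) with hY
  have hC0 : 0 ≤ C := by positivity
  have hd' : (0 : ℝ) < d := by exact_mod_cast hd
  have hL' : (1 : ℝ) ≤ L := by exact_mod_cast hL
  have hY0 : 0 ≤ Y := Real.log_nonneg (by
    have : (0 : ℝ) ≤ T * L / d := by positivity
    linarith)
  have haS : ‖aStar‖ ≤ 1 := by simpa using haStar
  have hA : ∀ t ∈ Finset.Ico lo T, ‖A t‖ ≤ 1 := fun t ht => by
    rw [Finset.mem_Ico] at ht
    obtain ⟨⟨ϑ, hfeas, -⟩, -⟩ := hround t ht.1 ht.2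
    simpa using hfeas.1
  -- Since `lam ≤ 1`, one has `lam ≤ √lam`; with the factor 3 lost in the choice of the core set
  -- this gives `3 √s / lam`.
  have hCσ : √S.card / √(lamMin (fun p : Fin L => θ p.succ) S) + 1 ≤ C := by
    have hlams : lam ≤ √lam := Real.le_sqrt_of_sq_le (by nlinarith)
    have hσ0 : 0 < √(lamMin (fun p : Fin L => θ p.succ) S) := Real.sqrt_pos.mpr hlamS
    rw [hC]
    refine add_le_add ?_ le_rfl
    rw [div_le_div_iff₀ hσ0 hlam0]
    nlinarith [Real.sqrt_nonneg (S.card : ℝ),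
      mul_le_mul_of_nonneg_left (hlams.trans hlam) (Real.sqrt_nonneg (S.card : ℝ))]
  set x : ℕ → ℝ := fun t => weightedNorm (design 1 A (queried I (I t) lo t))⁻¹ (A t) with hx
  have hx0 : ∀ t ∈ Finset.Ico lo T, 0 ≤ x t := fun t _ => weightedNorm_nonneg _ _
  have hx1 : ∀ t ∈ Finset.Ico lo T, x t ≤ 1 := fun t ht =>
    (weightedNorm_inv_le_norm (design_posDef _ _) (design_sub_one_posSemidef _ _) _).trans (hA t ht)
  have hr : ∀ t ∈ Finset.Ico lo T, ⟪aStar - A t, thetaPerp θ⟫_ℝ ≤ 2 := fun t ht =>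
    inner_sub_le_two haS (hA t ht) (norm_thetaPerp_le (hθ 0))
  have hrx : ∀ t ∈ Finset.Ico lo T, ⟪aStar - A t, thetaPerp θ⟫_ℝ ≤ 2 * (C * b * x t) := by
    intro t ht
    have hAt := hA t ht
    have hx0t := hx0 t ht
    rw [Finset.mem_Ico] at ht
    obtain ⟨⟨ϑ, hfeas, hopt⟩, hIt, hwidth⟩ := hround t ht.1 ht.2
    have hw : ∀ j ∈ coreIndices S, |⟪A t, θ j - ϑ j⟫_ℝ| ≤ 2 * (b * x t) := fun j hj => by
      refine (abs_inner_sub_le (hconf t ht.1 ht.2 j hj) (hfeas.2 j hj) (A t)).trans ?_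
      refine mul_le_mul_of_nonneg_left ((hwidth j hj).trans ?_) zero_le_two
      rw [width, mul_comm]
      exact mul_le_mul_of_nonneg_right
        (sqrtBeta_mono hδ ((card_queried_le _ _ _ _).trans ht.2.le)) hx0t
    have hmaxθ : ‖thetaPerp θ‖ ≤ ⟪aStar, thetaPerp θ⟫_ℝ :=
      norm_le_inner_of_isMaxOn fun b hb => haStar' hb
    have h1 := instant_regret_le hS (hθ 0) hAt hlamS
      (by rw [value, hperp]; exact hmaxθ)
      (hopt aStar θ ⟨haStar, fun j hj => hconf t ht.1 ht.2 j hj⟩)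
      (fun a ha => hopt a ϑ ⟨ha, hfeas.2⟩) hw
    rw [value, value, hperp, ← inner_sub_left] at h1
    refine h1.trans ((mul_le_mul_of_nonneg_right hCσ (by positivity)).trans_eq ?_)
    ring
  have hI : ∀ t ∈ Finset.Ico lo T, I t ∈ coreIndices S := fun t ht => by
    rw [Finset.mem_Ico] at ht
    exact (hround t ht.1 ht.2).2.1
  have hcard : (coreIndices S).card = S.card + 1 := by
    rw [coreIndices, Finset.card_insert_of_notMem (by simp [Fin.succ_ne_zero]), Finset.card_map]
  have hpot : ∑ t ∈ Finset.Ico lo T, Real.log (1 + x t ^ 2) ≤ (S.card + 1) * (d * Y) := by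
    rw [sum_log_one_add_weightedNorm A I hT hI]
    refine (Finset.sum_le_card_nsmul _ _ (d * Y) fun j _ => ?_).trans_eq ?_
    · refine (log_det_design_le hd A _ fun u hu => hA u (Finset.mem_filter.mp hu).1).trans ?_
      refine mul_le_mul_of_nonneg_left (Real.log_le_log (by positivity) ?_) hd'.le
      have h2 : ((queried I j lo T).card : ℝ) ≤ T := by exact_mod_cast card_queried_le I j lo T
      refine add_le_add le_rfl (div_le_div_of_nonneg_right (h2.trans ?_) hd'.le)
      exact le_mul_of_one_le_right (Nat.cast_nonneg T) hL'
    · rw [hcard, nsmul_eq_mul]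
      push_cast
      ring
  obtain ⟨h1, h2⟩ := sum_le_of_sum_log_le (K := C * b) (by positivity)
    (U := Finset.Ico lo T) (T := T) (by simp) hr hrx hx0 hx1 hpot
  constructor
  · refine h2.trans ?_
    have h3 : (T : ℝ) * (2 * ((S.card + 1) * (d * Y))) = 2 * (S.card + 1) * (T * d * Y) := by ring
    rw [h3, Real.sqrt_mul (by positivity), Real.sqrt_mul (by positivity)]
    have hs1 : √(S.card : ℝ) ≤ √((S.card : ℝ) + 1) := Real.sqrt_le_sqrt (by linarith)
    have hs2 : 1 ≤ √((S.card : ℝ) + 1) := Real.one_le_sqrt.mpr (by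
      linarith [(Nat.cast_nonneg S.card : (0 : ℝ) ≤ S.card)])
    have hss : √((S.card : ℝ) + 1) * √((S.card : ℝ) + 1) = S.card + 1 :=
      Real.mul_self_sqrt (by positivity)
    -- The summand 1 is absorbed because `lam ≤ 1`. The argument produces the constant `8 √2`, below
    -- the stated `12 √2`.
    have h4 : C ≤ 4 * √((S.card : ℝ) + 1) / lam := by
      rw [hC, le_div_iff₀ hlam0, add_mul, div_mul_cancel₀ _ hlam0.ne']
      nlinarith
    have h5 : C * √((S.card : ℝ) + 1) ≤ 4 * ((S.card + 1) / lam) := by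
      refine (mul_le_mul_of_nonneg_right h4 (Real.sqrt_nonneg _)).trans_eq ?_
      rw [div_mul_eq_mul_div, mul_assoc, hss, mul_div_assoc]
    have h6 : 0 ≤ √2 * √(T * d * Y) * b := by positivity
    have h7 : 0 ≤ (S.card + 1) / lam := by positivity
    calc 2 * (C * b) * (√2 * √((S.card : ℝ) + 1) * √(T * d * Y))
        = 2 * (C * √((S.card : ℝ) + 1)) * (√2 * √(T * d * Y) * b) := by ring
      _ ≤ 12 * ((S.card + 1) / lam) * (√2 * √(T * d * Y) * b) := by
          refine mul_le_mul_of_nonneg_right ?_ h6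
          linarith
      _ = _ := by ring
  · refine h1.trans_eq ?_
    congr 2
    ring

end Optimistic

/-! ### Predictable actions and the good event. -/

section GoodEvent

variable {d L : ℕ}

/-- The event of `measure_selfNormalized_le` on one sample path. -/
def SelfNormalizedBound (η : ℕ → ℝ) (A : ℕ → Vec d) (δ : ℝ) (T : ℕ) : Prop :=
  ∀ t ≤ T, weightedNorm (design 1 A (Finset.range t))⁻¹ (∑ u ∈ Finset.range t, η u • A u) ^ 2 ≤
    2 * Real.log (1 / δ) + Real.log (design 1 A (Finset.range t)).det

/-- The threshold of the while loop of CORE-SET. -/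
def coreThreshold (d L : ℕ) (δ : ℝ) (n : ℕ) : ℝ :=
  32 * L * (d * Real.log 6 + Real.log (2 * L / δ)) / √((n : ℝ) + 1)

theorem coreContinue_iff (s : ℕ) (ρ₀ δ : ℝ) (A : ℕ → Vec d) (I : ℕ → Fin (L + 1)) (X : ℕ → ℝ)
    (n : ℕ) : coreContinue s 1 1 ρ₀ (δ / (2 * L)) A I X n ↔
      ∀ S : Finset (Fin L), S.card = s →
        lamMin (coreEstimate ρ₀ A I X n) S ≤ coreThreshold d L δ n := by
  have : 16 * L * 1 * (1 + 1) * (d * Real.log 6 + Real.log (1 / (δ / (2 * L)))) / √((n : ℝ) + 1) =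
      coreThreshold d L δ n := by
    rw [coreThreshold, one_div_div]
    ring
  rw [coreContinue, this]

/-- The while loop has ended by round `u`, expressed in terms of the noise alone. -/
def switched (s : ℕ) (ρ₀ δ : ℝ) (θ : Fin (L + 1) → Vec d) (η : ℕ → ℝ) (u : ℕ) : Prop :=
  ∃ n, n * (d * L) ≤ u ∧ ∃ S : Finset (Fin L), S.card = s ∧
    coreThreshold d L δ n < lamMin (coreApprox ρ₀ θ η n) S

open Classical in
/-- The action of round `u` if this is an optimistic round in which `j` is queried, else `0`. -/
def optAction (s : ℕ) (ρ₀ δ : ℝ) (θ : Fin (L + 1) → Vec d) (j : Fin (L + 1)) (A : ℕ → Vec d)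
    (I : ℕ → Fin (L + 1)) (η : ℕ → ℝ) (u : ℕ) : Vec d :=
  if switched s ρ₀ δ θ η u ∧ I u = j ∧ ‖A u‖ ≤ 1 then A u else 0

theorem pass_index_lt {n k : ℕ} (hk : k < n) (i : Fin d) (p : Fin L) :
    k * (d * L) + i * L + p < n * (d * L) := by
  have h1 : (i : ℕ) * L + p < d * L := by
    calc (i : ℕ) * L + p < i * L + L := by have := p.2; omega
      _ = (i + 1) * L := by ring
      _ ≤ d * L := Nat.mul_le_mul_right L i.2
  calc k * (d * L) + i * L + p < k * (d * L) + d * L := by omega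
    _ = (k + 1) * (d * L) := by ring
    _ ≤ n * (d * L) := Nat.mul_le_mul_right _ hk

theorem exists_pass_index {n t : ℕ} (ht : t < n * (d * L)) :
    ∃ k < n, ∃ (i : Fin d) (p : Fin L), t = k * (d * L) + i * L + p := by
  have hdL : 0 < d * L := Nat.pos_of_ne_zero fun h => by simp [h] at ht
  have hL : 0 < L := Nat.pos_of_mul_pos_left hdL
  refine ⟨t / (d * L), Nat.div_lt_of_lt_mul (by rwa [mul_comm]),
    ⟨t % (d * L) / L, Nat.div_lt_of_lt_mul ((Nat.mod_lt _ hdL).trans_eq (mul_comm _ _))⟩,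
    ⟨t % (d * L) % L, Nat.mod_lt _ hL⟩, ?_⟩
  simp only
  rw [add_assoc, Nat.div_add_mod' (t % (d * L)) L, Nat.div_add_mod' t (d * L)]

theorem measurable_coreApprox {α : Type*} [MeasurableSpace α] (ρ₀ : ℝ) (θ : Fin (L + 1) → Vec d)
    {η : ℕ → α → ℝ} {n : ℕ} (hη : ∀ t < n * (d * L), Measurable (η t)) :
    Measurable fun a => coreApprox ρ₀ θ (fun t => η t a) n := by
  refine measurable_pi_lambda _ fun p => ?_
  unfold coreApprox coreNoise
  have h : Measurable fun a => ∑ k ∈ Finset.range n, ∑ i : Fin d,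
      η (k * (d * L) + i * L + p) a • (EuclideanSpace.single i 1 : Vec d) :=
    Finset.measurable_fun_sum _ fun k hk => Finset.measurable_fun_sum _ fun i _ =>
      (hη _ (pass_index_lt (Finset.mem_range.mp hk) i p)).smul_const _
  exact Measurable.const_smul (h.const_add ((n : ℝ) • θ p.succ)) (ρ₀ + n)⁻¹

/-- Only passes completed by round `u` enter, hence only the noise of rounds before `u`; this keeps
the truncated actions predictable. -/
theorem measurableSet_switched {α : Type*} [MeasurableSpace α] {s : ℕ} (hs : 0 < s) (ρ₀ δ : ℝ)
    (θ : Fin (L + 1) → Vec d) {η : ℕ → α → ℝ} {u : ℕ} (hη : ∀ t < u, Measurable (η t)) :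
    MeasurableSet {a | switched s ρ₀ δ θ (fun t => η t a) u} := by
  have : {a | switched s ρ₀ δ θ (fun t => η t a) u} =
      ⋃ n ∈ {n | n * (d * L) ≤ u}, ⋃ S ∈ {S : Finset (Fin L) | S.card = s},
        (fun a => lamMin (coreApprox ρ₀ θ (fun t => η t a) n) S) ⁻¹'
          Set.Ioi (coreThreshold d L δ n) := by
    ext a
    simp [switched]
  rw [this]
  refine MeasurableSet.biUnion (Set.to_countable _) fun n hn =>
    MeasurableSet.biUnion (Set.to_countable _) fun S hS => ?_
  have hS' : S.Nonempty := Finset.card_pos.mp (hs.trans_eq hS.symm)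
  exact (continuous_lamMin hS').measurable.comp
    (measurable_coreApprox ρ₀ θ fun t ht => hη t (ht.trans_le hn)) measurableSet_Ioi

theorem measurable_optAction {α : Type*} [MeasurableSpace α] {s : ℕ} (hs : 0 < s) (ρ₀ δ : ℝ)
    (θ : Fin (L + 1) → Vec d) (j : Fin (L + 1)) {A : ℕ → α → Vec d} {I : ℕ → α → Fin (L + 1)}
    {η : ℕ → α → ℝ} {u : ℕ} (hη : ∀ t < u, Measurable (η t)) (hA : Measurable (A u))
    (hI : Measurable (I u)) :
    Measurable fun a =>
      optAction s ρ₀ δ θ j (fun t => A t a) (fun t => I t a) (fun t => η t a) u := by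
  classical
  unfold optAction
  refine Measurable.ite ?_ hA measurable_const
  exact (measurableSet_switched hs ρ₀ δ θ hη).inter
    ((hI (measurableSet_singleton j)).inter (hA.norm measurableSet_Iic))

theorem measure_not_selfNormalizedBound_le {Ω : Type*} {mΩ : MeasurableSpace Ω} {P : Measure Ω}
    [IsProbabilityMeasure P] {ℱ : Filtration ℕ mΩ} {A₀ : ℕ → Ω → Vec d} {I : ℕ → Ω → Fin (L + 1)}
    {η : ℕ → Ω → ℝ} (hη : IsBanditNoise P 1 ℱ A₀ I η) {A : ℕ → Ω → Vec d}
    (hA : ∀ t, Measurable[ℱ t] (A t)) {δ : ℝ} (hδ : 0 < δ) (T : ℕ) :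
    P {ω | ¬ SelfNormalizedBound (fun t => η t ω) (fun t => A t ω) δ T} ≤ ENNReal.ofReal δ := by
  refine (measure_mono fun ω hω => ?_).trans (measure_selfNormalized_le hη.noise_meas
    hη.exp_integrable (fun t l => by simpa using hη.subgaussian t l) hA hδ T)
  simp only [SelfNormalizedBound, Set.mem_ofPred_eq, not_forall, not_le] at hω
  obtain ⟨t, ht, h⟩ := hω
  exact ⟨t, ht, h.le⟩

end GoodEvent

/-! ### Deterministic analysis of one good sample path. -/

section SamplePath

variable {d L s T : ℕ} {ρ₀ δ : ℝ} {θ : Fin (L + 1) → Vec d} {A : ℕ → Vec d}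
  {I : ℕ → Fin (L + 1)} {η X : ℕ → ℝ}

theorem core_error_le (hρ₀ : ρ₀ = 0 ∨ ρ₀ = 1) (hθ : ∀ j, ‖θ j‖ ≤ 1)
    (hgood : ∀ p : Fin L, SelfNormalizedBound η (coreAction d p) (δ / (2 * L)) T) {n : ℕ}
    (hn : 1 ≤ n) (hnT : n * (d * L) ≤ T) (p : Fin L) :
    ‖coreApprox ρ₀ θ η n p - θ p.succ‖ ≤
      √((4 * (d * Real.log (n + 1)) + 8 * Real.log (2 * L / δ) + 2) / (n + 1)) := by
  refine Real.le_sqrt_of_sq_le (norm_coreApprox_sub_sq_le hρ₀ hθ hn (norm_coreNoise_sq_le ?_))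
  have h := hgood p _ hnT
  rwa [one_div_div] at h

theorem log_two_mul_div_nonneg (hL : 0 < L) (hδ₀ : 0 < δ) (hδ₁ : δ < 1) :
    0 ≤ Real.log (2 * L / δ) := by
  have hL' : (1 : ℝ) ≤ L := by exact_mod_cast hL
  refine Real.log_nonneg ?_
  rw [le_div_iff₀ hδ₀]
  linarith

theorem core_error_radicand_nonneg {l : ℝ} (hl : 0 ≤ l) (n : ℕ) :
    0 ≤ (4 * (d * Real.log (n + 1)) + 8 * l + 2) / ((n : ℝ) + 1) := by
  have : 0 ≤ Real.log ((n : ℝ) + 1) := Real.log_nonneg (by simp)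
  positivity

theorem coreApprox_zero (ρ₀ : ℝ) (θ : Fin (L + 1) → Vec d) (η : ℕ → ℝ) :
    coreApprox ρ₀ θ η 0 = fun _ => 0 := by
  ext1 p
  simp [coreApprox, coreNoise]

theorem core_length_le (hd : 0 < d) (hL : 0 < L) (hδ₀ : 0 < δ) (hδ₁ : δ < 1)
    (hρ₀ : ρ₀ = 0 ∨ ρ₀ = 1) (hθ : ∀ j, ‖θ j‖ ≤ 1)
    (hgood : ∀ p : Fin L, SelfNormalizedBound η (coreAction d p) (δ / (2 * L)) T)
    {S : Finset (Fin L)} (hS : S.Nonempty) {lam : ℝ} (hlam0 : 0 < lam)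
    (hlam : lam = lamMin (fun p : Fin L => θ p.succ) S) {n : ℕ} (hnT : n * (d * L) ≤ T)
    (hcont : lamMin (coreApprox ρ₀ θ η n) S ≤ coreThreshold d L δ n) :
    (n : ℝ) + 1 ≤ (48 * L * (d * Real.log 6 + Real.log (2 * L / δ)) / lam) ^ 2 := by
  set l := Real.log (2 * L / δ) with hl
  have hl0 : 0 ≤ l := log_two_mul_div_nonneg hL hδ₀ hδ₁
  have hL' : (1 : ℝ) ≤ L := by exact_mod_cast hL
  have hd' : (1 : ℝ) ≤ d := by exact_mod_cast hd
  have h6 := threeHalves_le_log_six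
  set W := d * Real.log 6 + l with hW
  have hW1 : 1 ≤ W := by nlinarith
  have hlam1 : lam ≤ 1 := hlam ▸ lamMin_le_one hS fun p => hθ _
  by_contra! hlt
  have hbase : 48 * W ≤ 48 * L * W / lam := by
    rw [le_div_iff₀ hlam0]
    nlinarith [mul_nonneg (by linarith : (0 : ℝ) ≤ W) (sub_nonneg.mpr hL'),
      mul_nonneg (by linarith : (0 : ℝ) ≤ W) (sub_nonneg.mpr hlam1)]
  -- Arguing by contradiction supplies the lower bound on `n + 1` needed for the sharper error
  -- estimate, because `lam ≤ 1 ≤ L`.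
  have hlarge : (48 * W) ^ 2 ≤ (n : ℝ) + 1 :=
    (pow_le_pow_left₀ (by positivity) hbase 2).trans hlt.le
  have hn : 1 ≤ n := by
    by_contra! h0
    obtain rfl : n = 0 := by omega
    push_cast at hlarge
    nlinarith
  have herr := core_error_le hρ₀ hθ hgood hn hnT
  have hcard : (S.card : ℝ) ≤ L := by
    exact_mod_cast (Finset.card_le_univ S).trans_eq (Fintype.card_fin L)
  have hm : 0 < √((n : ℝ) + 1) := by positivity
  have hle := lamMin_le_of_perturbation (w := fun p : Fin L => θ p.succ) hS herr hcont (by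
    rw [Real.sq_sqrt (core_error_radicand_nonneg hl0 n)]
    calc (S.card : ℝ) * _ ≤ L * (8 / 5 * W / √((n : ℝ) + 1)) :=
          mul_le_mul hcard (coreError_le_of_large hd' hl0 hlarge)
            (core_error_radicand_nonneg hl0 n) (by positivity)
      _ = _ := by rw [coreThreshold]; ring)
  rw [← hlam, coreThreshold, ← mul_div_assoc, le_div_iff₀ hm] at hle
  have h1 : √((n : ℝ) + 1) ≤ 48 * L * W / lam := by
    rw [le_div_iff₀ hlam0]
    linarith
  have h2 := pow_le_pow_left₀ hm.le h1 2
  rw [Real.sq_sqrt (by positivity)] at h2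
  linarith

theorem sqrt_lamMin_coreSet_le (hd : 0 < d) (hL : 0 < L) (hδ₀ : 0 < δ) (hδ₁ : δ < 1)
    (hρ₀ : ρ₀ = 0 ∨ ρ₀ = 1) (hθ : ∀ j, ‖θ j‖ ≤ 1)
    (hgood : ∀ p : Fin L, SelfNormalizedBound η (coreAction d p) (δ / (2 * L)) T)
    {S S' : Finset (Fin L)} (hS : S.Nonempty) (hcard : S'.card = S.card) {n : ℕ}
    (hnT : n * (d * L) ≤ T) (hgt : coreThreshold d L δ n < lamMin (coreApprox ρ₀ θ η n) S)
    (hmax : lamMin (coreApprox ρ₀ θ η n) S' ≤ lamMin (coreApprox ρ₀ θ η n) S) :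
    0 < lamMin (fun p : Fin L => θ p.succ) S ∧
      √(lamMin (fun p : Fin L => θ p.succ) S') ≤ 3 * √(lamMin (fun p : Fin L => θ p.succ) S) := by
  have hl0 : 0 ≤ Real.log (2 * L / δ) := log_two_mul_div_nonneg hL hδ₀ hδ₁
  have hd' : (1 : ℝ) ≤ d := by exact_mod_cast hd
  have hτ : 0 ≤ coreThreshold d L δ n := by
    have := threeHalves_le_log_six
    rw [coreThreshold]
    positivity
  -- Before the first pass all estimates are zero, so the nonnegative threshold cannot be exceeded.
  have hn : 1 ≤ n := by
    by_contra! h0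
    obtain rfl : n = 0 := by omega
    rw [coreApprox_zero, lamMin_zero hS] at hgt
    exact absurd hgt (not_lt.mpr hτ)
  have hcardL : (S.card : ℝ) ≤ L := by
    exact_mod_cast (Finset.card_le_univ S).trans_eq (Fintype.card_fin L)
  refine sqrt_lamMin_le_three_mul (w := fun p : Fin L => θ p.succ) hS hcard
    (core_error_le hρ₀ hθ hgood hn hnT) hτ hgt ?_ hmax
  rw [Real.sq_sqrt (core_error_radicand_nonneg hl0 n)]
  calc (S.card : ℝ) * _ ≤ L * (8 * (d * Real.log 6 + Real.log (2 * L / δ)) / √((n : ℝ) + 1)) :=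
        mul_le_mul hcardL (coreError_le hd' hl0 (by simp)) (core_error_radicand_nonneg hl0 n)
          (by positivity)
    _ = _ := by rw [coreThreshold]; ring

/-- Rounds with zero action change neither the noise sum nor the design matrix, so a bound over all
rounds transfers to the rounds in which one index is queried. -/
theorem sum_range_of_restrict {M : Type*} [AddCommMonoid M] {f : ℕ → Vec d → M}
    (hf : ∀ u, f u 0 = 0) {A' : ℕ → Vec d} {U : Finset ℕ} {t : ℕ} (hU : U ⊆ Finset.range t)
    (h1 : ∀ u ∈ U, A' u = A u) (h2 : ∀ u < t, u ∉ U → A' u = 0) :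
    ∑ u ∈ Finset.range t, f u (A' u) = ∑ u ∈ U, f u (A u) := by
  rw [← Finset.sum_subset hU fun u hu hu' => by rw [h2 u (Finset.mem_range.mp hu) hu', hf]]
  exact Finset.sum_congr rfl fun u hu => by rw [h1 u hu]

theorem mem_confSet_of_selfNormalizedBound (hd : 2 ≤ d) {δ' : ℝ} (hδ₀ : 0 < δ') (hδ₁ : δ' ≤ 1)
    (hθ : ∀ j, ‖θ j‖ ≤ 1) (hX : ∀ t, X t = ⟪A t, θ (I t)⟫_ℝ + η t) {j : Fin (L + 1)}
    {A' : ℕ → Vec d} {lo t : ℕ} (htT : t ≤ T) (hgood : SelfNormalizedBound η A' δ' T)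
    (hA : ∀ u ∈ queried I j lo t, ‖A u‖ ≤ 1)
    (h1 : ∀ u ∈ queried I j lo t, A' u = A u) (h2 : ∀ u < t, u ∉ queried I j lo t → A' u = 0) :
    θ j ∈ confSet 1 1 1 δ' A X (queried I j lo t) := by
  have hU : queried I j lo t ⊆ Finset.range t := fun u hu => by
    simp only [queried, Finset.mem_filter, Finset.mem_Ico] at hu
    exact Finset.mem_range.mpr hu.1.2
  have h := hgood t htT
  rw [sum_range_of_restrict (f := fun u a => η u • a) (fun u => smul_zero _) hU h1 h2,
    design, sum_range_of_restrict (f := fun _ a => outer a) (fun _ => outer_zero) hU h1 h2] at h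
  refine mem_confSet hd hδ₀ hδ₁ (hθ j) (fun u hu => ?_) hA h
  rw [hX, (Finset.mem_filter.mp hu).2]

theorem regret_le_of_selfNormalizedBound (hd : 2 ≤ d) (hL : 0 < L) (hδ₀ : 0 < δ) (hδ₁ : δ < 1)
    (hθ : ∀ j, ‖θ j‖ ≤ 1) (hs0 : 0 < s)
    (hs' : ∀ S : Finset (Fin L), s < S.card → lamMin (fun p : Fin L => θ p.succ) S = 0)
    {lam : ℝ} (hlam0 : 0 < lam) {S₀ : Finset (Fin L)} (hS₀ : S₀.card = s)
    (hlam : lam = lamMin (fun p : Fin L => θ p.succ) S₀)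
    {aStar : Vec d} (haStar : aStar ∈ Metric.closedBall 0 1)
    (haStar' : IsMaxOn (fun a => ⟪a, thetaPerp θ⟫_ℝ) (Metric.closedBall 0 1) aStar)
    (hX : ∀ t, X t = ⟪A t, θ (I t)⟫_ℝ + η t) (hρ₀ : ρ₀ = 0 ∨ ρ₀ = 1)
    (hrun : isProtectedLinUCB s 1 1 1 ρ₀ δ T A I X)
    (hcore : ∀ p : Fin L, SelfNormalizedBound η (coreAction d p) (δ / (2 * L)) T)
    (hopt : ∀ j, SelfNormalizedBound η (optAction s ρ₀ δ θ j A I η) (δ / (2 * (L + 1))) T) :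
    regret θ aStar A T ≤
        12 * √2 * ((s + 1) / lam) * √(T * d * Real.log (1 + T * L / d)) *
            sqrtBeta d 1 1 1 (δ / (2 * (L + 1))) T +
          4608 * L ^ 3 * d * (d * Real.log 6 + Real.log (2 * L / δ)) ^ 2 / lam ^ 2 ∧
      regret θ aStar A T ≤
        2 * √(((3 * √s / lam + 1) ^ 2 * sqrtBeta d 1 1 1 (δ / (2 * (L + 1))) T ^ 2 + 1) *
              (s + 1) * T * d * Real.log (1 + T * L / d)) +
          4608 * L ^ 3 * d * (d * Real.log 6 + Real.log (2 * L / δ)) ^ 2 / lam ^ 2 := by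
  classical
  have hd0 : 0 < d := by omega
  have hdL : 0 < d * L := Nat.mul_pos hd0 hL
  have hS₀' : S₀.Nonempty := Finset.card_pos.mp (hs0.trans_eq hS₀.symm)
  have hδ' : 0 < δ / (2 * ((L : ℝ) + 1)) := by positivity
  have hδ'1 : δ / (2 * ((L : ℝ) + 1)) ≤ 1 := by
    rw [div_le_one (by positivity)]
    have : (0 : ℝ) ≤ L := Nat.cast_nonneg L
    linarith
  set cont : ℕ → Prop := coreContinue s 1 1 ρ₀ (δ / (2 * L)) A I X with hcontdef
  -- The horizon may be reached during CORE-SET, so `n` is the first pass count at which either the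
  -- horizon is covered or the loop ends; in the former case the optimistic phase is empty.
  have hex : ∃ n, T ≤ n * (d * L) ∨ ¬ cont n := ⟨T, Or.inl (Nat.le_mul_of_pos_right T hdL)⟩
  obtain ⟨n, hn, hmin⟩ : ∃ n, (T ≤ n * (d * L) ∨ ¬ cont n) ∧
      ∀ m < n, m * (d * L) < T ∧ cont m := by
    refine ⟨Nat.find hex, Nat.find_spec hex, fun m hm => ?_⟩
    have := Nat.find_min hex hm
    push Not at this
    exact this
  have hplay : ∀ k < n, ∀ (i : Fin d) (p : Fin L), k * (d * L) + i * L + p < T →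
      A (k * (d * L) + i * L + p) = EuclideanSpace.single i 1 ∧
      I (k * (d * L) + i * L + p) = p.succ := fun k hk i p hT =>
    hrun.1 k i p hT fun m hm => (hmin m (hm.trans_lt hk)).2
  have hest : ∀ m ≤ n, m * (d * L) ≤ T → coreEstimate ρ₀ A I X m = coreApprox ρ₀ θ η m := by
    intro m hm hmT
    ext1 p
    exact coreEstimate_eq_coreApprox hρ₀ hX (fun k hk i p =>
      hplay k (hk.trans_le hm) i p ((pass_index_lt hk i p).trans_le hmT)) p
  -- The length bound is applied to the last count `m = n - 1` at which the loop continued; the loop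
  -- counter there is `m + 1 = n`.
  have hlength : (n : ℝ) ≤ (48 * L * (d * Real.log 6 + Real.log (2 * L / δ)) / lam) ^ 2 := by
    rcases Nat.eq_zero_or_pos n with rfl | hpos
    · push_cast
      positivity
    · obtain ⟨m, rfl⟩ : ∃ m, n = m + 1 := ⟨n - 1, by omega⟩
      obtain ⟨h1, h2⟩ := hmin m m.lt_succ_self
      rw [hcontdef, coreContinue_iff, hest m m.le_succ h1.le] at h2
      push_cast
      exact core_length_le hd0 hL hδ₀ hδ₁ hρ₀ hθ hcore hS₀' hlam0 hlam h1.le (h2 S₀ hS₀)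
  set r : ℕ → ℝ := fun t => ⟪aStar - A t, thetaPerp θ⟫_ℝ with hr
  set lo := min (n * (d * L)) T with hlo
  have hsplit : regret θ aStar A T = ∑ t ∈ Finset.range lo, r t + ∑ t ∈ Finset.Ico lo T, r t :=
    (Finset.sum_range_add_sum_Ico r (min_le_right _ _)).symm
  have hcorereg : ∑ t ∈ Finset.range lo, r t ≤
      4608 * L ^ 3 * d * (d * Real.log 6 + Real.log (2 * L / δ)) ^ 2 / lam ^ 2 := by
    have h1 : ∀ t ∈ Finset.range lo, r t ≤ 2 := by
      intro t ht
      rw [Finset.mem_range, hlo, lt_min_iff] at ht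
      obtain ⟨k, hk, i, p, rfl⟩ := exists_pass_index ht.1
      refine inner_sub_le_two (by simpa using haStar) ?_ (norm_thetaPerp_le (hθ 0))
      rw [(hplay k hk i p ht.2).1]
      simp
    refine (Finset.sum_le_card_nsmul _ _ 2 h1).trans ?_
    rw [Finset.card_range, nsmul_eq_mul]
    have h2 : (lo : ℝ) ≤ n * (d * L) := by
      exact_mod_cast min_le_left (n * (d * L)) T
    calc (lo : ℝ) * 2 ≤ n * (d * L) * 2 := by linarith
      _ ≤ (48 * L * (d * Real.log 6 + Real.log (2 * L / δ)) / lam) ^ 2 * (d * L) * 2 := by gcongr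
      _ = _ := by ring
  suffices h : ∑ t ∈ Finset.Ico lo T, r t ≤
        12 * √2 * ((s + 1) / lam) * √(T * d * Real.log (1 + T * L / d)) *
          sqrtBeta d 1 1 1 (δ / (2 * (L + 1))) T ∧
      ∑ t ∈ Finset.Ico lo T, r t ≤
        2 * √(((3 * √s / lam + 1) ^ 2 * sqrtBeta d 1 1 1 (δ / (2 * (L + 1))) T ^ 2 + 1) *
              (s + 1) * T * d * Real.log (1 + T * L / d)) by
    rw [hsplit, add_comm]
    exact ⟨add_le_add h.1 hcorereg, add_le_add h.2 hcorereg⟩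
  rcases le_or_gt T (n * (d * L)) with hT | hT
  · rw [hlo, min_eq_right hT, Finset.Ico_self, Finset.sum_empty]
    have := zero_le_one.trans (one_le_sqrtBeta (d := d) (δ / (2 * ((L : ℝ) + 1))) T)
    exact ⟨by positivity, by positivity⟩
  have hlo' : lo = n * (d * L) := min_eq_left hT.le
  have hnot : ¬ cont n := hn.resolve_left (not_le.mpr hT)
  obtain ⟨S, ⟨hScard, hSmax⟩, hround⟩ := hrun.2 n ⟨fun m hm => (hmin m hm).2, hnot⟩
  rw [← hlo'] at hround
  have hS : S.Nonempty := Finset.card_pos.mp (hs0.trans_eq hScard.symm)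
  rw [hcontdef, coreContinue_iff, hest n le_rfl hT.le] at hnot
  push Not at hnot
  rw [hest n le_rfl hT.le] at hSmax
  obtain ⟨S₁, hS₁, hS₁'⟩ := hnot
  obtain ⟨hlamS, hlamS'⟩ := sqrt_lamMin_coreSet_le hd0 hL hδ₀ hδ₁ hρ₀ hθ hcore hS (hS₀.trans hScard.symm) hT.le
    (hS₁'.trans_le (hSmax S₁ hS₁)) (hSmax S₀ hS₀)
  have hperp : projPerp ((fun p : Fin L => θ p.succ) '' (S : Set (Fin L))) (θ 0) = thetaPerp θ := by
    rw [thetaPerp, projPerp_eq_of_span_eq (span_image_eq_of_maximal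
      (v := fun p : Fin L => θ p.succ) ((lamMin_pos_iff hS).mp hlamS)
      fun S' h => hs' S' (hScard ▸ h))]
  -- On an actual run the noise-only description agrees with the start of the optimistic phase:
  -- earlier counts satisfied the loop condition, and `S₁` violates it at count `n`.
  have hswitched : ∀ u < T, switched s ρ₀ δ θ η u ↔ lo ≤ u := by
    intro u hu
    rw [hlo']
    constructor
    · rintro ⟨m, hm, S₂, hS₂, hlt⟩
      refine le_trans (Nat.mul_le_mul_right _ ?_) hm
      by_contra! hmn
      obtain ⟨h1, h2⟩ := hmin m hmn
      rw [hcontdef, coreContinue_iff, hest m hmn.le h1.le] at h2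
      exact absurd hlt (not_lt.mpr (h2 S₂ hS₂))
    · exact fun h => ⟨n, h, S₁, hS₁, hS₁'⟩
  have hnormA : ∀ u, lo ≤ u → u < T → ‖A u‖ ≤ 1 := fun u h1 h2 => by
    obtain ⟨⟨ϑ, hfeas, -⟩, -⟩ := hround u h1 h2
    simpa using hfeas.1
  have hconf : ∀ t, lo ≤ t → t < T → ∀ j ∈ coreIndices S,
      θ j ∈ confSet 1 1 1 (δ / (2 * (L + 1))) A X (queried I j lo t) := by
    intro t _ htT j _
    refine mem_confSet_of_selfNormalizedBound hd hδ' hδ'1 hθ hX htT.le (hopt j) ?_ ?_ ?_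
    · intro u hu
      simp only [queried, Finset.mem_filter, Finset.mem_Ico] at hu
      exact hnormA u hu.1.1 (hu.1.2.trans htT)
    · intro u hu
      simp only [queried, Finset.mem_filter, Finset.mem_Ico] at hu
      have huT := hu.1.2.trans htT
      exact if_pos ⟨(hswitched u huT).mpr hu.1.1, hu.2, hnormA u hu.1.1 huT⟩
    · intro u hut hu
      simp only [queried, Finset.mem_filter, Finset.mem_Ico, not_and] at hu
      exact if_neg fun h => hu ⟨(hswitched u (hut.trans htT)).mp h.1, hut⟩ h.2.1
  have hlam1 : lam ≤ 1 := hlam ▸ lamMin_le_one hS₀' fun p => hθ _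
  have hfinal := optimistic_regret_le hd0 hL hS hθ hδ' (min_le_right _ _ : lo ≤ T) hlam0 hlam1
    hlamS (hlam ▸ hlamS') hperp hround hconf haStar haStar'
  rw [hScard] at hfinal
  exact hfinal

end SamplePath

/-! ### Dimension one, and the order of the leading term. -/

theorem thetaPerp_eq_zero_of_dim_le_one {d L : ℕ} (hd : d ≤ 1) {θ : Fin (L + 1) → Vec d}
    {S : Finset (Fin L)} (hS : S.Nonempty) (h : 0 < lamMin (fun p : Fin L => θ p.succ) S) :
    thetaPerp θ = 0 := by
  obtain ⟨p, hp⟩ := hS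
  have hne : θ p.succ ≠ 0 := ((lamMin_pos_iff ⟨p, hp⟩).mp h).ne_zero ⟨p, hp⟩
  have hmem := projPerp_mem (Set.range fun p : Fin L => θ p.succ) (θ 0)
  have horth : ⟪thetaPerp θ, θ p.succ⟫_ℝ = 0 :=
    (Submodule.mem_orthogonal' _ _).mp hmem _ (Submodule.subset_span ⟨p, rfl⟩)
  by_contra h0
  -- Two nonzero orthogonal vectors need at least two dimensions.
  have hli : LinearIndependent ℝ ![thetaPerp θ, θ p.succ] := by
    refine linearIndependent_of_ne_zero_of_inner_eq_zero (𝕜 := ℝ) ?_ ?_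
    · intro i
      fin_cases i
      · exact h0
      · exact hne
    · intro i j hij
      fin_cases i <;> fin_cases j
      · exact absurd rfl hij
      · exact horth
      · exact (real_inner_comm _ _).trans horth
      · exact absurd rfl hij
  have := hli.fintype_card_le_finrank
  simp at this
  omega

/-- With `l` the final logarithm, `l ≥ 1` because its argument is at least 4. Then `s + 1 ≤ 2s` and
the radius is at most `2 √(d l)`, so the constant becomes `12 · 2 · 2 = 48`. -/
theorem leading_term_le {d L s T : ℕ} (hd : 0 < d) (hL : 0 < L) (hs : 0 < s) {δ lam : ℝ}
    (hδ₀ : 0 < δ) (hδ₁ : δ < 1) (hlam : 0 < lam) :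
    12 * √2 * ((s + 1) / lam) * √(T * d * Real.log (1 + T * L / d)) *
        sqrtBeta d 1 1 1 (δ / (2 * (L + 1))) T ≤
      48 * √2 / lam * (s * d * √T) * Real.log (2 * (L + 1) * (T + 1) / δ) := by
  have hd' : (1 : ℝ) ≤ d := by exact_mod_cast hd
  have hL' : (1 : ℝ) ≤ L := by exact_mod_cast hL
  have hs' : (1 : ℝ) ≤ s := by exact_mod_cast hs
  have hT' : (0 : ℝ) ≤ T := Nat.cast_nonneg T
  set l := Real.log (2 * (L + 1) * (T + 1) / δ) with hl
  have harg : 2 * (L + 1) * (T + 1) ≤ 2 * (L + 1) * ((T : ℝ) + 1) / δ :=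
    le_div_self (by positivity) hδ₀ hδ₁.le
  have hl1 : 1 ≤ l := by
    rw [hl, Real.le_log_iff_exp_le (by positivity)]
    refine (Real.exp_one_lt_d9.le.trans ?_).trans harg
    nlinarith
  have hlog : Real.log (1 + T * L / d) ≤ l := by
    refine Real.log_le_log (by positivity) (le_trans ?_ harg)
    have : (T * L / d : ℝ) ≤ T * L := div_le_self (by positivity) hd'
    nlinarith [mul_nonneg hT' (by linarith : (0 : ℝ) ≤ L)]
  have hβ : sqrtBeta d 1 1 1 (δ / (2 * (L + 1))) T ≤ 2 * √(d * l) := by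
    have h1 : (1 + T * 1 ^ 2 / 1) / (δ / (2 * (L + 1))) = 2 * (L + 1) * ((T : ℝ) + 1) / δ := by
      field_simp
      ring
    have h2 : 1 ≤ √(d * l) := Real.one_le_sqrt.mpr (by nlinarith)
    rw [sqrtBeta, h1, one_mul, Real.sqrt_one, one_mul]
    linarith
  have h3 : √(T * d * Real.log (1 + T * L / d)) ≤ √T * √(d * l) := by
    rw [← Real.sqrt_mul hT', ← mul_assoc]
    exact Real.sqrt_le_sqrt (mul_le_mul_of_nonneg_left hlog (by positivity))
  have hdl : √(d * l) * √(d * l) = d * l := Real.mul_self_sqrt (by positivity)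
  calc 12 * √2 * ((s + 1) / lam) * √(T * d * Real.log (1 + T * L / d)) *
        sqrtBeta d 1 1 1 (δ / (2 * (L + 1))) T
      ≤ 12 * √2 * (2 * s / lam) * (√T * √(d * l)) * (2 * √(d * l)) := by
        have h0 := zero_le_one.trans (one_le_sqrtBeta (d := d) (δ / (2 * ((L : ℝ) + 1))) T)
        gcongr
        linarith
    _ = 48 * √2 / lam * (s * √T) * (√(d * l) * √(d * l)) := by ring
    _ = _ := by rw [hdl]; ring

end ProtectedBandit

end

/-! ### The high-probability regret bound. -/

theorem mainTheorem1 {Ω : Type*} {mΩ : MeasurableSpace Ω} (P : Measure Ω) [IsProbabilityMeasure P]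
    (d L s T : ℕ) (δ : ℝ) (hδ₀ : 0 < δ) (hδ₁ : δ < 1)
    -- the unknown vectors: `θ 0` is the target, the others are protected
    (θ : Fin (L + 1) → ProtectedBandit.Vec d) (hθ : ∀ j, ‖θ j‖ ≤ 1)
    -- `s` is the dimension of the protected subspace
    (hs : ∃ S : Finset (Fin L), S.card = s ∧
      0 < ProtectedBandit.lamMin (fun p : Fin L => θ p.succ) S)
    (hs' : ∀ S : Finset (Fin L), s < S.card →
      ProtectedBandit.lamMin (fun p : Fin L => θ p.succ) S = 0)
    (lam : ℝ)
    (hlam : IsGreatest {x : ℝ | ∃ S : Finset (Fin L), S.card = s ∧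
      x = ProtectedBandit.lamMin (fun p : Fin L => θ p.succ) S} lam)
    -- the optimal action
    (aStar : ProtectedBandit.Vec d) (haStar : aStar ∈ Metric.closedBall 0 1)
    (haStar' : IsMaxOn (fun a => ⟪a, ProtectedBandit.thetaPerp θ⟫_ℝ) (Metric.closedBall 0 1) aStar)
    -- the interaction, with `R = 1`
    (ℱ : Filtration ℕ mΩ) (A : ℕ → Ω → ProtectedBandit.Vec d) (I : ℕ → Ω → Fin (L + 1))
    (η X : ℕ → Ω → ℝ) (hη : ProtectedBandit.IsBanditNoise P 1 ℱ A I η)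
    (hX : ∀ t ω, X t ω = ⟪A t ω, θ (I t ω)⟫_ℝ + η t ω)
    -- the learner runs Protected LinUCB with `M = R = ρ = 1`; the estimates of the CORE-SET phase
    -- are either regularised (`ρ₀ = 1`) or not (`ρ₀ = 0`)
    (ρ₀ : ℝ) (hρ₀ : ρ₀ = 0 ∨ ρ₀ = 1)
    (hrun : ∀ᵐ ω ∂P, ProtectedBandit.isProtectedLinUCB s 1 1 1 ρ₀ δ T
      (fun t => A t ω) (fun t => I t ω) (fun t => X t ω)) :
    ENNReal.ofReal (1 - δ) ≤ P {ω |
      ProtectedBandit.regret θ aStar (fun t => A t ω) T ≤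
        12 * √2 * ((s + 1) / lam) * √(T * d * Real.log (1 + T * L / d)) *
            ProtectedBandit.sqrtBeta d 1 1 1 (δ / (2 * (L + 1))) T +
          4608 * L ^ 3 * d * (d * Real.log 6 + Real.log (2 * L / δ)) ^ 2 / lam ^ 2 ∧
      ProtectedBandit.regret θ aStar (fun t => A t ω) T ≤
        2 * √(((3 * √s / lam + 1) ^ 2 *
                ProtectedBandit.sqrtBeta d 1 1 1 (δ / (2 * (L + 1))) T ^ 2 + 1) *
              (s + 1) * T * d * Real.log (1 + T * L / d)) +
          4608 * L ^ 3 * d * (d * Real.log 6 + Real.log (2 * L / δ)) ^ 2 / lam ^ 2} ∧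
    12 * √2 * ((s + 1) / lam) * √(T * d * Real.log (1 + T * L / d)) *
        ProtectedBandit.sqrtBeta d 1 1 1 (δ / (2 * (L + 1))) T ≤
      48 * √2 / lam * (s * d * √T) * Real.log (2 * (L + 1) * (T + 1) / δ) := by
  open ProtectedBandit in
  obtain ⟨S, hScard, hSpos⟩ := hs
  have hS : S.Nonempty := by
    by_contra h
    rw [Finset.not_nonempty_iff_eq_empty.mp h] at hSpos
    -- For the empty set the matrix is zero and has no nonzero eigenvalue; the infimum of the empty
    -- set is 0 by convention, so positivity forces `s > 0`.
    have h0 : lamMin (fun p : Fin L => θ p.succ) ∅ = 0 := by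
      rw [lamMin]
      split_ifs
      · have : {x : ℝ | x ≠ 0 ∧ Module.End.HasEigenvalue
            (Matrix.toLin' (∑ i ∈ (∅ : Finset (Fin L)), outer (θ i.succ))) x} = ∅ := by
          ext x
          simp only [Finset.sum_empty, map_zero, Set.mem_ofPred_eq, Set.mem_empty_iff_false,
            iff_false, not_and]
          intro hx hev
          obtain ⟨v, hv⟩ := hev.exists_hasEigenvector
          have := hv.apply_eq_smul
          rw [LinearMap.zero_apply] at this
          exact hv.2 ((smul_eq_zero.mp this.symm).resolve_left hx)
        rw [this, Real.sInf_empty]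
      · rfl
    exact hSpos.ne' h0
  have hs0 : 0 < s := hScard ▸ hS.card_pos
  have hL : 0 < L := hS.choose.pos
  have hd : 0 < d := by
    obtain ⟨p, hp⟩ := hS
    have hne : θ p.succ ≠ 0 := ((lamMin_pos_iff ⟨p, hp⟩).mp hSpos).ne_zero ⟨p, hp⟩
    by_contra! h
    obtain rfl : d = 0 := by omega
    exact hne (Subsingleton.elim _ _)
  have hlam0 : 0 < lam := hSpos.trans_le (hlam.2 ⟨S, hScard, rfl⟩)
  obtain ⟨S₀, hS₀, hS₀'⟩ := hlam.1
  refine ⟨?_, leading_term_le hd hL hs0 hδ₀ hδ₁ hlam0⟩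
  set G := {ω |
      ProtectedBandit.regret θ aStar (fun t => A t ω) T ≤
        12 * √2 * ((s + 1) / lam) * √(T * d * Real.log (1 + T * L / d)) *
            ProtectedBandit.sqrtBeta d 1 1 1 (δ / (2 * (L + 1))) T +
          4608 * L ^ 3 * d * (d * Real.log 6 + Real.log (2 * L / δ)) ^ 2 / lam ^ 2 ∧
      ProtectedBandit.regret θ aStar (fun t => A t ω) T ≤
        2 * √(((3 * √s / lam + 1) ^ 2 *
                ProtectedBandit.sqrtBeta d 1 1 1 (δ / (2 * (L + 1))) T ^ 2 + 1) *
              (s + 1) * T * d * Real.log (1 + T * L / d)) +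
          4608 * L ^ 3 * d * (d * Real.log 6 + Real.log (2 * L / δ)) ^ 2 / lam ^ 2} with hG
  suffices hbad : P Gᶜ ≤ ENNReal.ofReal δ by
    rw [ENNReal.ofReal_sub 1 hδ₀.le, ENNReal.ofReal_one, tsub_le_iff_right]
    -- Subadditivity suffices, so measurability of `G` is not required.
    calc (1 : ENNReal) = P (G ∪ Gᶜ) := by rw [Set.union_compl_self, measure_univ]
      _ ≤ P G + P Gᶜ := measure_union_le _ _
      _ ≤ _ := by gcongr
  have hβ0 := zero_le_one.trans (one_le_sqrtBeta (d := d) (δ / (2 * ((L : ℝ) + 1))) T)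
  rcases Nat.lt_or_ge d 2 with hd2 | hd2
  -- The confidence radius is only justified for `d ≥ 2`; in dimension one the residual `θ_⊥` is
  -- zero and there is no regret.
  · have hzero := thetaPerp_eq_zero_of_dim_le_one (by omega : d ≤ 1) hS hSpos
    have : Gᶜ = ∅ := by
      rw [Set.compl_empty_iff, Set.eq_univ_iff_forall]
      intro ω
      have hr : regret θ aStar (fun t => A t ω) T = 0 := by
        simp [regret, hzero]
      rw [hG, Set.mem_ofPred_eq, hr]
      exact ⟨by positivity, by positivity⟩
    rw [this, measure_empty]
    exact zero_le
  set B₁ : Fin L → Set Ω := fun p => {ω | ¬ SelfNormalizedBound (fun t => η t ω)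
    (coreAction d p) (δ / (2 * L)) T} with hB₁
  set B₂ : Fin (L + 1) → Set Ω := fun j => {ω | ¬ SelfNormalizedBound (fun t => η t ω)
    (optAction s ρ₀ δ θ j (fun t => A t ω) (fun t => I t ω) fun t => η t ω)
    (δ / (2 * (L + 1))) T} with hB₂
  have hL' : (0 : ℝ) < L := by exact_mod_cast hL
  have h1 : ∀ p, P (B₁ p) ≤ ENNReal.ofReal (δ / (2 * L)) := fun p =>
    measure_not_selfNormalizedBound_le hη (A := fun u _ => coreAction d p u)
      (fun t => measurable_const) (by positivity) T
  have h2 : ∀ j, P (B₂ j) ≤ ENNReal.ofReal (δ / (2 * (L + 1))) := fun j =>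
    measure_not_selfNormalizedBound_le hη (A := fun u ω =>
      optAction s ρ₀ δ θ j (fun t => A t ω) (fun t => I t ω) (fun t => η t ω) u)
      (fun t => @measurable_optAction d L Ω (ℱ t) s hs0 ρ₀ δ θ j A I η t
        (fun u hu => (hη.noise_meas u).mono (ℱ.mono hu) le_rfl) (hη.action_meas t)
        (hη.index_meas t)) (by positivity) T
  have hsub : Gᶜ ≤ᵐ[P] ((⋃ p, B₁ p) ∪ ⋃ j, B₂ j : Set Ω) := by
    filter_upwards [hrun] with ω hω hωG
    by_contra hgood
    have hgood' : ω ∉ (⋃ p, B₁ p) ∪ ⋃ j, B₂ j := hgood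
    simp only [Set.mem_union, Set.mem_iUnion, not_or, not_exists, hB₁, hB₂, Set.mem_ofPred_eq,
      not_not] at hgood'
    exact hωG (regret_le_of_selfNormalizedBound hd2 hL hδ₀ hδ₁ hθ hs0 hs' hlam0 hS₀ hS₀' haStar
      haStar' (fun t => hX t ω) hρ₀ hω hgood'.1 hgood'.2)
  calc P Gᶜ ≤ P ((⋃ p, B₁ p) ∪ ⋃ j, B₂ j) := measure_mono_ae hsub
    _ ≤ P (⋃ p, B₁ p) + P (⋃ j, B₂ j) := measure_union_le _ _
    _ ≤ ∑ p, P (B₁ p) + ∑ j, P (B₂ j) :=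
        add_le_add (measure_iUnion_fintype_le P B₁) (measure_iUnion_fintype_le P B₂)
    _ ≤ ∑ _p : Fin L, ENNReal.ofReal (δ / (2 * L)) +
          ∑ _j : Fin (L + 1), ENNReal.ofReal (δ / (2 * (L + 1))) :=
        add_le_add (Finset.sum_le_sum fun p _ => h1 p) (Finset.sum_le_sum fun j _ => h2 j)
    _ = ENNReal.ofReal δ := by
        rw [← ENNReal.ofReal_sum_of_nonneg fun _ _ => by positivity,
          ← ENNReal.ofReal_sum_of_nonneg fun _ _ => by positivity,
          ← ENNReal.ofReal_add (by positivity) (by positivity)]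
        congr 1
        simp only [Finset.sum_const, Finset.card_univ, Fintype.card_fin, nsmul_eq_mul]
        push_cast
        field_simp
        ring
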